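/- Let $d\ge 1$, let $\Omega\subset\mathbb R^d$ be a nonempty bounded open convex set that is strictly convex (every open segment joining two distinct points of $\overline\Omega$ lies in the interior of $\overline\Omega$), and let $\sigma>0$. There is a constant $C=C(\Omega,d,\sigma)$ with the following property. Let $k\in\{0,1\}$, $0<\alpha\le 1$ and $f,u\in C^{k,\alpha}(\overline\Omega)$, where $|w|_{C^{k,\alpha}}$ denotes the seminorm given by the best $\alpha$-Hölder constant of $D^kw$ on $\overline\Omega$, and assume that $|u|_{C^{k,\alpha}}\ne 0$. Let $u$ be the viscosity solution of $$\min\{f-u,\ \lambda_1[D^2u]\}=0\ \text{ in }\Omega,\qquad u=f\ \text{ on }\partial\Omega,$$ where $\lambda_1$ denotes the smallest eigenvalue (so $u$ is the convex envelope of $f$; at a subsolution the left-hand side is $\ge 0$). Let $\mathcal T_h$ be a finite conforming mesh of closed $d$-simplices $T$ with convex union contained in $\overline\Omega$, let $\Omega_h$ be the interior of this union, and suppose that every node on $\partial\Omega_h$ lies on $\partial\Omega$. Let $h=\max_T h_T$, where $h_T$ is the diameter of $T$ and $\rho_T$ is the diameter of the largest ball inscribed in $T$, and suppose that the mesh is shape-regular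 and quasi-uniform with constant $\sigma$: $h_T\le\sigma\rho_T$ and $h\le\sigma h_T$ for all $T\in\mathcal T_h$. Nodes on $\partial\Omega$ are called boundary nodes, the other nodes interior nodes. Set $$R_\alpha(u)=|u|_{C^{k,\alpha}}^{\frac1{2+k+\alpha}}\bigl(|u|_{C^{k,\alpha}}+|f|_{C^{k,\alpha}}\bigr)^{-\frac1{2+k+\alpha}},\qquad \delta=R_\alpha(u)\,h^{\frac{k+\alpha}{2+k+\alpha}},\qquad \theta=R_\alpha(u)^{-1}h^{\frac{2}{2+k+\alpha}},$$ and suppose that $\theta\le 1$ (equivalently $\delta\ge h$). Let $\mathbb S_\theta$ be a finite set of unit vectors such that every unit vector is within distance $\theta$ of $\mathbb S_\theta$. Let $u_\varepsilon$, $\varepsilon=(h,\delta,\theta)$, be the discrete solution of the two-scale method: $u_\varepsilon$ is continuous and piecewise linear over $\mathcal T_h$, $u_\varepsilon(x_i)=f(x_i)$ at every boundary node $x_i$, and at every interior node $x_i$, with $\delta_i=\min\{\delta,\operatorname{dist}(x_i,\partial\Omega_h)\}$, $$\min\Bigl\{f(x_i)-u_\varepsilon(x_i),\ \min_{v\in\mathbb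 S_\theta}\frac{u_\varepsilon(x_i+\delta_iv)-2u_\varepsilon(x_i)+u_\varepsilon(x_i-\delta_iv)}{\delta_i^2}\Bigr\}=0 .$$ Then $$\|u-u_\varepsilon\|_{L^\infty(\Omega_h)}\le C\bigl(|u|_{C^{k,\alpha}}+|f|_{C^{k,\alpha}}\bigr)\,h^{\frac{(k+\alpha)^2}{2+k+\alpha}} .$$ In particular the error is at most $C(|u|_{C^{1,1}}+|f|_{C^{1,1}})\,h$ if $k=\alpha=1$, and at most $C(|u|_{C^{0,1}}+|f|_{C^{0,1}})\,h^{1/3}$ if $k=0$, $\alpha=1$. -/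

import Mathlib

open scoped NNReal

noncomputable section

namespace ConvexEnvelope

variable {d : ℕ}

/-! ### Hölder classes -/

/-- `w ∈ C^{k,α}(closure Ω)`: `w` is continuous on `closure Ω`, of class `C^k` in `Ω`, and its
`k`-th derivative is `α`-Hölder continuous in `Ω`. For a bounded convex open `Ω` this forces all
derivatives of order at most `k` to extend continuously to `closure Ω`. -/
structure IsHolderClass (k : ℕ) (α : ℝ≥0) (Ω : Set (EuclideanSpace ℝ (Fin d)))
    (w : EuclideanSpace ℝ (Fin d) → ℝ) : Prop where
  continuousOn : ContinuousOn w (closure Ω)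
  contDiffOn : ContDiffOn ℝ k w Ω
  holder : MemHolder α (Ω.domRestrict (iteratedFDeriv ℝ k w))

/-- The seminorm `|w|_{C^{k,α}}`: the best `α`-Hölder constant of the `k`-th derivative of `w`
in `Ω` (the same as on `closure Ω`, by continuity). -/
def holderSeminorm (k : ℕ) (α : ℝ≥0) (Ω : Set (EuclideanSpace ℝ (Fin d)))
    (w : EuclideanSpace ℝ (Fin d) → ℝ) : ℝ :=
  nnHolderNorm α (Ω.domRestrict (iteratedFDeriv ℝ k w))

/-! ### The fully nonlinear obstacle problem -/

/-- The smallest eigenvalue of the Hessian of `φ` at `x`, as the minimum over unit vectors `v` of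
the second directional derivative of `φ` in the direction `v`. -/
def lambdaOne (φ : EuclideanSpace ℝ (Fin d) → ℝ) (x : EuclideanSpace ℝ (Fin d)) : ℝ :=
  ⨅ v : Metric.sphere (0 : EuclideanSpace ℝ (Fin d)) 1, iteratedFDeriv ℝ 2 φ x ![v.1, v.1]

/-- `u` is a viscosity solution of `min {f - u, λ₁[D²u]} = 0` in `Ω`, `u = f` on `∂Ω`, the
Dirichlet condition being attained in the classical sense. Only the values of `u` and `f` on
`closure Ω` matter. -/
structure IsViscositySolution (Ω : Set (EuclideanSpace ℝ (Fin d)))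
    (f u : EuclideanSpace ℝ (Fin d) → ℝ) : Prop where
  continuousOn : ContinuousOn u (closure Ω)
  subsolution : ∀ φ : EuclideanSpace ℝ (Fin d) → ℝ, ContDiffOn ℝ 2 φ Ω → ∀ x ∈ Ω,
    IsLocalMax (fun y => u y - φ y) x → 0 ≤ min (f x - u x) (lambdaOne φ x)
  supersolution : ∀ φ : EuclideanSpace ℝ (Fin d) → ℝ, ContDiffOn ℝ 2 φ Ω → ∀ x ∈ Ω,
    IsLocalMin (fun y => u y - φ y) x → min (f x - u x) (lambdaOne φ x) ≤ 0
  boundary : ∀ x ∈ frontier Ω, u x = f x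

/-! ### Meshes -/

/-- The vertex sets of the elements (`d`-dimensional closed simplices) of a simplicial complex. -/
def elements (K : Geometry.SimplicialComplex ℝ (EuclideanSpace ℝ (Fin d))) :
    Set (Finset (EuclideanSpace ℝ (Fin d))) :=
  {T | T ∈ K.faces ∧ T.card = d + 1}

/-- The diameter `h_T` of the closed simplex with vertex set `T`. -/
def elementDiam (T : Finset (EuclideanSpace ℝ (Fin d))) : ℝ :=
  Metric.diam (convexHull ℝ (T : Set (EuclideanSpace ℝ (Fin d))))

/-- The diameter `ρ_T` of the largest ball inscribed in the closed simplex with vertex set `T`. -/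
def inscribedDiam (T : Finset (EuclideanSpace ℝ (Fin d))) : ℝ :=
  sSup {ρ : ℝ | 0 ≤ ρ ∧ ∃ x : EuclideanSpace ℝ (Fin d),
    Metric.closedBall x (ρ / 2) ⊆ convexHull ℝ (T : Set (EuclideanSpace ℝ (Fin d)))}

/-- The mesh size `h`, the largest diameter of an element. -/
def meshSize (K : Geometry.SimplicialComplex ℝ (EuclideanSpace ℝ (Fin d))) : ℝ :=
  sSup (elementDiam '' elements K)

/-- `Ω_h`, the interior of the union of the elements. -/
def meshDomain (K : Geometry.SimplicialComplex ℝ (EuclideanSpace ℝ (Fin d))) :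
    Set (EuclideanSpace ℝ (Fin d)) :=
  interior K.space

/-- Boundary nodes: the nodes that lie on `∂Ω`. -/
def boundaryNodes (Ω : Set (EuclideanSpace ℝ (Fin d)))
    (K : Geometry.SimplicialComplex ℝ (EuclideanSpace ℝ (Fin d))) :
    Set (EuclideanSpace ℝ (Fin d)) :=
  K.vertices ∩ frontier Ω

/-- Interior nodes: all the other nodes. -/
def interiorNodes (Ω : Set (EuclideanSpace ℝ (Fin d)))
    (K : Geometry.SimplicialComplex ℝ (EuclideanSpace ℝ (Fin d))) :
    Set (EuclideanSpace ℝ (Fin d)) :=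
  K.vertices \ boundaryNodes Ω K

/-- `K` is a conforming mesh in `Ω` made of finitely many closed `d`-simplices, whose union is
convex and contained in `closure Ω`, whose nodes on `∂Ω_h` all lie on `∂Ω`, and which is
shape-regular and quasi-uniform with constant `σ`. -/
structure IsMesh (Ω : Set (EuclideanSpace ℝ (Fin d))) (σ : ℝ)
    (K : Geometry.SimplicialComplex ℝ (EuclideanSpace ℝ (Fin d))) : Prop where
  nonempty : K.faces.Nonempty
  finite : K.faces.Finite
  pure : ∀ s ∈ K.faces, ∃ T ∈ elements K, s ⊆ T
  convex : Convex ℝ K.space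
  subset : K.space ⊆ closure Ω
  boundary : ∀ x ∈ K.vertices, x ∈ frontier (meshDomain K) → x ∈ frontier Ω
  shapeRegular : ∀ T ∈ elements K, elementDiam T ≤ σ * inscribedDiam T
  quasiUniform : ∀ T ∈ elements K, meshSize K ≤ σ * elementDiam T

/-- The space `𝕍_h` of continuous piecewise linear functions over the mesh (only the values on the
union of the elements matter). -/
structure IsPiecewiseLinear (K : Geometry.SimplicialComplex ℝ (EuclideanSpace ℝ (Fin d)))
    (w : EuclideanSpace ℝ (Fin d) → ℝ) : Prop where
  continuousOn : ContinuousOn w K.space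
  affine : ∀ T ∈ elements K, ∃ A : EuclideanSpace ℝ (Fin d) →ᵃ[ℝ] ℝ,
    Set.EqOn w A (convexHull ℝ (T : Set (EuclideanSpace ℝ (Fin d))))

/-! ### The two-scale method -/

/-- `S` is a finite discretization `𝕊_θ` of the unit sphere with parameter `θ`. -/
structure IsSphereDiscretization (θ : ℝ) (S : Finset (EuclideanSpace ℝ (Fin d))) : Prop where
  norm_eq_one : ∀ v ∈ S, ‖v‖ = 1
  approx : ∀ v : EuclideanSpace ℝ (Fin d), ‖v‖ = 1 → ∃ v' ∈ S, ‖v - v'‖ ≤ θ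

/-- The step `δ_i = min {δ, dist (x_i, ∂Ω_h)}` at the node `x = x_i`. -/
def stepSize (K : Geometry.SimplicialComplex ℝ (EuclideanSpace ℝ (Fin d))) (δ : ℝ)
    (x : EuclideanSpace ℝ (Fin d)) : ℝ :=
  min δ (Metric.infDist x (frontier (meshDomain K)))

/-- The centered second difference of `w` at the node `x` in the direction `v`. -/
def secondDiff (K : Geometry.SimplicialComplex ℝ (EuclideanSpace ℝ (Fin d))) (δ : ℝ)
    (w : EuclideanSpace ℝ (Fin d) → ℝ) (x v : EuclideanSpace ℝ (Fin d)) : ℝ :=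
  (w (x + stepSize K δ x • v) - 2 * w x + w (x - stepSize K δ x • v)) / stepSize K δ x ^ 2

/-- The two-scale operator
`T_ε[w; f](x) = min {f x - w x, min over v ∈ 𝕊_θ of the second difference of w at x along v}`. -/
def twoScaleOp (K : Geometry.SimplicialComplex ℝ (EuclideanSpace ℝ (Fin d))) (δ : ℝ)
    (S : Finset (EuclideanSpace ℝ (Fin d))) (f w : EuclideanSpace ℝ (Fin d) → ℝ)
    (x : EuclideanSpace ℝ (Fin d)) : ℝ :=
  min (f x - w x) (⨅ v : {v // v ∈ S}, secondDiff K δ w x v.1)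

/-- `w` is a discrete solution of the two-scale method. -/
structure IsDiscreteSolution (Ω : Set (EuclideanSpace ℝ (Fin d)))
    (K : Geometry.SimplicialComplex ℝ (EuclideanSpace ℝ (Fin d))) (δ : ℝ)
    (S : Finset (EuclideanSpace ℝ (Fin d))) (f w : EuclideanSpace ℝ (Fin d) → ℝ) : Prop where
  piecewiseLinear : IsPiecewiseLinear K w
  interior : ∀ x ∈ interiorNodes Ω K, twoScaleOp K δ S f w x = 0
  boundary : ∀ x ∈ boundaryNodes Ω K, w x = f x

/-- `R_α(u) = |u|^{1/(2+k+α)} (|u| + |f|)^{-1/(2+k+α)}`, with the `C^{k,α}` seminorms. -/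
def scaleFactor (k : ℕ) (α : ℝ≥0) (Ω : Set (EuclideanSpace ℝ (Fin d)))
    (f u : EuclideanSpace ℝ (Fin d) → ℝ) : ℝ :=
  holderSeminorm k α Ω u ^ (1 / (2 + (k : ℝ) + (α : ℝ))) *
    (holderSeminorm k α Ω u + holderSeminorm k α Ω f) ^ (-(1 / (2 + (k : ℝ) + (α : ℝ))))

end ConvexEnvelope

end

section

open Set Filter Topology

namespace ConvexEnvelope

/-! Write `β = k + α`, `N` and `F` for the seminorms of `u` and `f`, and `h` for the mesh size. The
two sides of the error are estimated by different discrete comparison arguments.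

Lower bound: a viscosity solution is convex and lies below `f`. A convex function has nonnegative
second differences and lies below its piecewise linear interpolant, so discrete comparison gives `u
≤ uε` with no error at all (`IsDiscreteSolution.le_of_convexOn`).

Upper bound: maximize `uε - u - b` over the nodes, with `b ≥ 0` a concave barrier
(`IsDiscreteSolution.le_of_barrier`). At each interior node either `f - u` is already small, or in
some discrete direction the second difference of `b` outweighs that of `u` together with the
interpolation error `N h^β`.

The structural fact is that `x` lies in the convex hull of those contact points `u = f` at which a
supporting affine function at `x` touches `u` (`IsViscositySolution.mem_convexHull_contact`). By
Carathéodory this gives a dichotomy (`IsViscositySolution.exists_contact_or_flat`). If a contact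
point lies within `d * δ`, then `f - u` is at most `(N + F) (d δ)^β`, because the gradients of `f`
and `u` agree at an interior contact point. Otherwise `u` is affine on a segment of half-length `δ`
centred at `x`. Moving its ends to the nearest discrete direction displaces them by at most `δ θ =
h` and costs `2 N h^β`, since `u` has the same gradient at both ends. The paraboloid part of `b`, of
size `N h^β / δ^2`, absorbs this.

The dichotomy is used at nodes at distance at least `d * δ` from the boundary of the mesh domain.
Closer nodes are near a boundary node, where `u = f`. For `k = 0` this suffices. For `k = 1` the
square root of the distance to the boundary serves as barrier: it is strongly concave in directions
near the normal, and truncation at distance `d * δ` keeps its contribution of order `N δ^β`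
(`secondDiff_sqrt_infDist_le`).

The total error is of order `N h^β / δ^2 + (N + F) δ^β`, and the prescribed `δ` makes these two
terms equal (`scale_estimates`). -/

section

/-! ### Quadratic test functions and the smallest eigenvalue of their Hessian. -/

section Quadratic

variable {E : Type*} [NormedAddCommGroup E] [InnerProductSpace ℝ E]

/-- A quadratic polynomial with Hessian `2 A I + 2 B e ⊗ e`. -/
def quadTest (c : ℝ) (l : E →L[ℝ] ℝ) (A B : ℝ) (a e : E) (y : E) : ℝ :=
  c + l y + A * ‖y - a‖ ^ 2 + B * (inner ℝ e (y - a)) ^ 2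

lemma contDiff_quadTest (c : ℝ) (l : E →L[ℝ] ℝ) (A B : ℝ) (a e : E) {n : WithTop ℕ∞} :
    ContDiff ℝ n (quadTest c l A B a e) := by
  unfold quadTest
  have h1 : ContDiff ℝ n fun y : E => ‖y - a‖ ^ 2 := (contDiff_id.sub contDiff_const).norm_sq ℝ
  have h2 : ContDiff ℝ n fun y : E => (inner ℝ e (y - a) : ℝ) :=
    contDiff_const.inner ℝ (contDiff_id.sub contDiff_const)
  exact ((contDiff_const.add l.contDiff).add (contDiff_const.mul h1)).add
    (contDiff_const.mul (h2.pow 2))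

lemma hasFDerivAt_quadTest (c : ℝ) (l : E →L[ℝ] ℝ) (A B : ℝ) (a e x : E) :
    HasFDerivAt (quadTest c l A B a e)
      (l + (2 * A) • innerSL ℝ (x - a) + (2 * B * inner ℝ e (x - a)) • innerSL ℝ e) x := by
  have h0 : HasFDerivAt (fun y : E => y - a) (ContinuousLinearMap.id ℝ E) x :=
    (hasFDerivAt_id x).sub_const a
  have h1 := (h0.norm_sq).const_mul A
  have h2 : HasFDerivAt (fun y : E => (inner ℝ e (y - a) : ℝ)) (innerSL ℝ e) x := by
    simpa using! ((innerSL ℝ e).hasFDerivAt (x := x - a)).comp x h0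
  have h3 := (h2.pow 2).const_mul B
  have h4 := (((l.hasFDerivAt (x := x)).const_add c).add h1).add h3
  refine h4.congr_fderiv ?_
  ext v
  simp
  ring

lemma iteratedFDeriv_quadTest (c : ℝ) (l : E →L[ℝ] ℝ) (A B : ℝ) (a e x v : E) :
    iteratedFDeriv ℝ 2 (quadTest c l A B a e) x ![v, v] =
      2 * A * ‖v‖ ^ 2 + 2 * B * (inner ℝ e v) ^ 2 := by
  rw [iteratedFDeriv_two_apply]
  have h : fderiv ℝ (quadTest c l A B a e) = fun x =>
      (l + (2 * A) • innerSL ℝ (x - a) + (2 * B * inner ℝ e (x - a)) • innerSL ℝ e) := by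
    ext1 y
    exact (hasFDerivAt_quadTest c l A B a e y).fderiv
  rw [h]
  have h0 : HasFDerivAt (fun y : E => y - a) (ContinuousLinearMap.id ℝ E) x :=
    (hasFDerivAt_id x).sub_const a
  have h1 : HasFDerivAt (fun y : E => innerSL ℝ (y - a)) (innerSL ℝ : E →L[ℝ] E →L[ℝ] ℝ) x := by
    exact (((innerSL ℝ : E →L[ℝ] E →L[ℝ] ℝ).hasFDerivAt (x := x - a)).comp x h0).congr_fderiv
      (ContinuousLinearMap.comp_id _)
  have h2 : HasFDerivAt (fun y : E => (inner ℝ e (y - a) : ℝ)) (innerSL ℝ e) x := by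
    simpa using! ((innerSL ℝ e).hasFDerivAt (x := x - a)).comp x h0
  have h3 := ((h1.const_smul (2 * A)).const_add l).add
    ((h2.const_mul (2 * B)).smul_const (innerSL ℝ e))
  have h4 : fderiv ℝ (fun x => (l + (2 * A) • innerSL ℝ (x - a) +
      (2 * B * inner ℝ e (x - a)) • innerSL ℝ e)) x = _ := h3.fderiv
  rw [h4]
  have h5 : innerSL ℝ v v = ‖v‖ ^ 2 := real_inner_self_eq_norm_sq v
  have h6 : ∀ J : E →L[ℝ] E →L[ℝ] ℝ,
      ((2 * A) • J + ((2 * B) • innerSL ℝ e).smulRight (innerSL ℝ e)) v v =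
        2 * A * J v v + 2 * B * inner ℝ e v * inner ℝ e v := fun J => by simp
  refine (h6 (innerSL ℝ)).trans ?_
  rw [h5]
  ring

end Quadratic

variable {d : ℕ}

lemma lambdaOne_quadTest_le (c : ℝ) (l : EuclideanSpace ℝ (Fin d) →L[ℝ] ℝ) (A B : ℝ)
    (a e x v : EuclideanSpace ℝ (Fin d)) (he : ‖e‖ = 1) (hv : ‖v‖ = 1) :
    lambdaOne (quadTest c l A B a e) x ≤ 2 * A + 2 * B * (inner ℝ e v) ^ 2 := by
  unfold lambdaOne
  -- A real infimum over a set unbounded below is 0 by default, so a lower bound has to be supplied.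
  have hb : BddBelow (range fun v : Metric.sphere (0 : EuclideanSpace ℝ (Fin d)) 1 =>
      iteratedFDeriv ℝ 2 (quadTest c l A B a e) x ![v.1, v.1]) := by
    refine ⟨2 * A - 2 * |B|, ?_⟩
    rintro _ ⟨⟨w, hw⟩, rfl⟩
    have hw : ‖w‖ = 1 := by simpa using hw
    simp only [iteratedFDeriv_quadTest, hw]
    have h1 : |inner ℝ e w| ≤ 1 := by simpa [he, hw] using abs_real_inner_le_norm e w
    have h2 : (inner ℝ e w : ℝ) ^ 2 ≤ 1 := (sq_le_one_iff_abs_le_one _).2 h1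
    have h3 := neg_abs_le B
    nlinarith [abs_nonneg B, sq_nonneg (inner ℝ e w : ℝ)]
  refine (ciInf_le hb ⟨v, by simpa using hv⟩).trans ?_
  simp [iteratedFDeriv_quadTest, hv]

lemma le_lambdaOne_quadTest (hd : 1 ≤ d) (c : ℝ) (l : EuclideanSpace ℝ (Fin d) →L[ℝ] ℝ) (A : ℝ)
    (a e x : EuclideanSpace ℝ (Fin d)) :
    2 * A ≤ lambdaOne (quadTest c l A 0 a e) x := by
  unfold lambdaOne
  -- In dimension 0 the unit sphere is empty and the infimum takes the default value 0.
  have : Nonempty (Fin d) := ⟨⟨0, hd⟩⟩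
  have : Nonempty (Metric.sphere (0 : EuclideanSpace ℝ (Fin d)) 1) :=
    (NormedSpace.sphere_nonempty.2 zero_le_one).to_subtype
  refine le_ciInf ?_
  rintro ⟨w, hw⟩
  have hw : ‖w‖ = 1 := by simpa using hw
  simp [iteratedFDeriv_quadTest, hw]

end

/-! ### Viscosity solutions: obstacle bound, convexity, and the role of the contact set. -/

section

variable {d : ℕ} {Ω : Set (EuclideanSpace ℝ (Fin d))} {f u : EuclideanSpace ℝ (Fin d) → ℝ}

/-- A viscosity solution does not exceed the obstacle. -/
lemma IsViscositySolution.le_of_mem (hu : IsViscositySolution Ω f u) (hΩ : IsOpen Ω)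
    (hf : ContinuousOn f (closure Ω)) {x : EuclideanSpace ℝ (Fin d)} (hx : x ∈ Ω) :
    u x ≤ f x := by
  by_contra! hlt
  have hux : ContinuousAt u x :=
    (hu.continuousOn.mono subset_closure).continuousAt (hΩ.mem_nhds hx)
  have hfx : ContinuousAt f x := (hf.mono subset_closure).continuousAt (hΩ.mem_nhds hx)
  have hev : ∀ᶠ y in 𝓝 x, y ∈ Ω ∧ f y < u y :=
    Filter.Eventually.and (hΩ.mem_nhds hx) (hfx.eventually_lt hux hlt)
  obtain ⟨ρ, hρ, hsub⟩ := Metric.nhds_basis_closedBall.eventually_iff.1 hev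
  have hcomp : IsCompact (Metric.closedBall x ρ) := isCompact_closedBall x ρ
  have hcont : ContinuousOn u (Metric.closedBall x ρ) :=
    hu.continuousOn.mono fun y hy => subset_closure (hsub hy).1
  obtain ⟨B, hB⟩ := hcomp.bddAbove_image hcont
  have hB' : ∀ y ∈ Metric.closedBall x ρ, u y ≤ B := fun y hy => hB ⟨y, hy, rfl⟩
  -- The paraboloid is so steep that the maximum of `u - φ` cannot be on the sphere of radius `ρ`.
  -- It is therefore an interior local maximum at a point where still `f < u`.
  set A : ℝ := (B - u x + 1) / ρ ^ 2 with hA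
  have hAρ : A * ρ ^ 2 = B - u x + 1 := by rw [hA]; field_simp
  let φ := quadTest 0 0 A 0 x (0 : EuclideanSpace ℝ (Fin d))
  have hφ : ∀ y, φ y = A * ‖y - x‖ ^ 2 := fun y => by simp [φ, quadTest]
  have hφs : ContDiff ℝ 2 φ := contDiff_quadTest _ _ _ _ _ _
  obtain ⟨z, hz, hmax⟩ := hcomp.exists_isMaxOn ⟨x, Metric.mem_closedBall_self hρ.le⟩
    (hcont.sub hφs.continuous.continuousOn)
  have hxz : u x ≤ u z - φ z := by
    have := hmax (Metric.mem_closedBall_self hρ.le)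
    simpa [hφ] using this
  have hzρ : dist z x < ρ := by
    refine lt_of_le_of_ne hz fun h => ?_
    rw [hφ, ← dist_eq_norm, h, hAρ] at hxz
    linarith [hB' z hz]
  have hloc : IsLocalMax (fun y => u y - φ y) z :=
    hmax.isLocalMax (Filter.mem_of_superset (Metric.isOpen_ball.mem_nhds hzρ)
      Metric.ball_subset_closedBall)
  have h1 := hu.subsolution φ hφs.contDiffOn z (hsub hz).1 hloc
  have h2 := (le_min_iff.1 h1).1
  linarith [(hsub hz).2]

lemma IsViscositySolution.le_obstacle (hu : IsViscositySolution Ω f u) (hΩ : IsOpen Ω)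
    (hf : ContinuousOn f (closure Ω)) {x : EuclideanSpace ℝ (Fin d)} (hx : x ∈ closure Ω) :
    u x ≤ f x := by
  by_cases h : x ∈ Ω
  · exact hu.le_of_mem hΩ hf h
  · exact (hu.boundary x (by rw [hΩ.frontier_eq]; exact ⟨hx, h⟩)).le

section Geometry

variable {E : Type*} [NormedAddCommGroup E] [InnerProductSpace ℝ E]

lemma norm_sub_axis_sq {e : E} (he : ‖e‖ = 1) (w : E) :
    ‖w - (inner ℝ e w : ℝ) • e‖ ^ 2 = ‖w‖ ^ 2 - (inner ℝ e w) ^ 2 := by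
  rw [norm_sub_sq_real, norm_smul, inner_smul_right, he, real_inner_comm, Real.norm_eq_abs,
    mul_one, sq_abs]
  ring

/-- In finite dimension the convex hull of a compact set is compact. -/
lemma isCompact_convexHull_of_isCompact [FiniteDimensional ℝ E] {D : Set E} (hD : IsCompact D) :
    IsCompact (convexHull ℝ D) := by
  rcases D.eq_empty_or_nonempty with rfl | ⟨p0, hp0⟩
  · simp
  set n := Module.finrank ℝ E + 1
  have hK : IsCompact (stdSimplex ℝ (Fin n) ×ˢ (Set.pi univ fun _ : Fin n => D)) :=
    (isCompact_stdSimplex ℝ (Fin n)).prod (isCompact_univ_pi fun _ => hD)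
  have hc : Continuous fun q : (Fin n → ℝ) × (Fin n → E) => ∑ i, q.1 i • q.2 i := by fun_prop
  convert! hK.image hc using 1
  ext x
  constructor
  · intro hx
    obtain ⟨ι, _, z, w, hz, hind, hw, hw1, hx⟩ := eq_pos_convex_span_of_mem_convexHull hx
    have hcard : Fintype.card ι ≤ Fintype.card (Fin n) := by
      rw [Fintype.card_fin]
      exact hind.card_le_finrank_succ.trans (Nat.succ_le_succ (Submodule.finrank_le _))
    obtain ⟨e⟩ := Function.Embedding.nonempty_of_card_le hcard
    -- Carathéodory gives at most `finrank + 1` points. The family is padded to exactly that size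
    -- with weight 0 at `p0`, which exhibits the hull as a continuous image of a compact set.
    refine ⟨(Function.extend e w 0, Function.extend e z fun _ => p0), ⟨⟨fun i => ?_, ?_⟩, ?_⟩, ?_⟩
    · by_cases h : ∃ j, e j = i
      · obtain ⟨j, rfl⟩ := h
        simpa [e.injective.extend_apply] using (hw j).le
      · simp [Function.extend_apply' _ _ _ h]
    · rw [← hw1]
      symm
      refine Fintype.sum_of_injective e e.injective _ _ (fun i hi => ?_) fun i => ?_
      · simp [Function.extend_apply' w _ i (show ¬∃ j, e j = i from hi)]
      · simp [e.injective.extend_apply]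
    · intro i _
      by_cases h : ∃ j, e j = i
      · obtain ⟨j, rfl⟩ := h
        simpa [e.injective.extend_apply] using hz ⟨j, rfl⟩
      · simpa [Function.extend_apply' _ _ _ h] using hp0
    · rw [← hx]
      symm
      refine Fintype.sum_of_injective e e.injective _ _ (fun i hi => ?_) fun i => ?_
      · simp [Function.extend_apply' w _ i (show ¬∃ j, e j = i from hi)]
      · simp [e.injective.extend_apply]
  · rintro ⟨⟨w, p⟩, ⟨hw, hp⟩, rfl⟩
    exact (convex_convexHull ℝ D).sum_mem (fun i _ => hw.1 i) hw.2
      fun i _ => subset_convexHull ℝ D (hp i (mem_univ i))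

end Geometry

set_option maxHeartbeats 800000 in
/-- A viscosity solution is convex. -/
lemma IsViscositySolution.convexOn (hu : IsViscositySolution Ω f u) (hΩ : IsOpen Ω)
    (hconv : Convex ℝ Ω) : ConvexOn ℝ Ω u := by
  refine ⟨hconv, fun a ha b hb s t hs ht hst => ?_⟩
  by_contra! hlt
  simp only [smul_eq_mul] at hlt
  have hab : a ≠ b := by
    rintro rfl
    rw [← add_smul, hst, one_smul, ← add_mul, hst, one_mul] at hlt
    exact lt_irrefl _ hlt
  set m := s • a + t • b with hm
  set len : ℝ := ‖b - a‖ with hlen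
  have hl : 0 < len := norm_pos_iff.2 (sub_ne_zero.2 hab.symm)
  set e := len⁻¹ • (b - a) with he_def
  have he : ‖e‖ = 1 := by
    rw [he_def, norm_smul, norm_inv, Real.norm_of_nonneg hl.le, ← hlen]; field_simp
  have hle : len • e = b - a := by rw [he_def, smul_smul, mul_inv_cancel₀ hl.ne', one_smul]
  set γ := u m - (s * u a + t * u b) with hγ
  have hγ0 : 0 < γ := by linarith
  -- a thin tube around the segment
  have hev : ∀ x ∈ Ω, ∃ ρ > 0, Metric.closedBall x ρ ⊆ {y | u y ≤ u x + γ / 4} := by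
    intro x hx
    have hux : ContinuousAt u x :=
      (hu.continuousOn.mono subset_closure).continuousAt (hΩ.mem_nhds hx)
    have : ∀ᶠ y in 𝓝 x, u y ≤ u x + γ / 4 :=
      (hux.eventually_lt_const (by linarith : u x < u x + γ / 4)).mono fun y hy => le_of_lt hy
    obtain ⟨ρ, hρ, h⟩ := Metric.nhds_basis_closedBall.eventually_iff.1 this
    exact ⟨ρ, hρ, fun y hy => h hy⟩
  obtain ⟨ρa, hρa, hBa⟩ := hev a ha
  obtain ⟨ρb, hρb, hBb⟩ := hev b hb
  have hsegc : IsCompact (segment ℝ a b) := by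
    rw [segment_eq_image_lineMap]
    exact isCompact_Icc.image AffineMap.lineMap_continuous
  obtain ⟨ρs, hρs, hseg⟩ := hsegc.exists_cthickening_subset_open hΩ (hconv.segment_subset ha hb)
  set ρ := min ρs (min ρa ρb) with hρ_def
  have hρ : 0 < ρ := lt_min hρs (lt_min hρa hρb)
  let τ : EuclideanSpace ℝ (Fin d) → ℝ := fun y => inner ℝ e (y - a)
  have hτc : Continuous τ := continuous_const.inner (continuous_id.sub continuous_const)
  let ν : EuclideanSpace ℝ (Fin d) → ℝ := fun y => ‖y - a - τ y • e‖
  have hνc : Continuous ν :=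
    ((continuous_id.sub continuous_const).sub (hτc.smul continuous_const)).norm
  have hνsq : ∀ y, ν y ^ 2 = ‖y - a‖ ^ 2 - τ y ^ 2 := fun y => norm_sub_axis_sq he (y - a)
  let Q := {y | (0 ≤ τ y ∧ τ y ≤ len) ∧ ν y ≤ ρ}
  have hdist : ∀ y, dist y (a + τ y • e) = ν y := fun y => by
    rw [dist_eq_norm, sub_add_eq_sub_sub]
  have hQΩ : Q ⊆ Ω := by
    rintro y ⟨⟨h0, h1⟩, h2⟩
    apply hseg
    refine Metric.mem_cthickening_of_dist_le y (a + τ y • e) ρs _ ?_ ?_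
    · rw [segment_eq_image']
      refine ⟨τ y / len, ⟨by positivity, (div_le_one hl).2 h1⟩, ?_⟩
      simp only [← hle, smul_smul]
      rw [div_mul_cancel₀ _ hl.ne']
    · rw [hdist]; exact h2.trans (min_le_left _ _)
  have hQc : IsCompact Q := by
    refine Metric.isCompact_of_isClosed_isBounded ?_ ?_
    · exact (((isClosed_le continuous_const hτc).inter (isClosed_le hτc continuous_const)).inter
        (isClosed_le hνc continuous_const))
    · refine (Metric.isBounded_closedBall (x := a) (r := len + ρ)).subset ?_
      rintro y ⟨⟨h0, h1⟩, h2⟩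
      have h3 := hνsq y
      have h4 : 0 ≤ ν y := norm_nonneg _
      rw [Metric.mem_closedBall, dist_eq_norm]
      refine abs_le_of_sq_le_sq' ?_ (by positivity) |>.2
      nlinarith
  have hcont : ContinuousOn u Q := hu.continuousOn.mono fun y hy => subset_closure (hQΩ hy)
  have hτm : τ m = t * len := by
    have h1 : m - a = (t * len) • e := by
      rw [mul_smul, hle, hm, show s = 1 - t by linarith]; module
    simp only [τ, h1, inner_smul_right, real_inner_self_eq_norm_sq, he]; ring
  have hνm : ν m = 0 := by
    have h1 : m - a = (t * len) • e := by
      rw [mul_smul, hle, hm, show s = 1 - t by linarith]; module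
    simp only [ν, hτm, h1, sub_self, norm_zero]
  have hmQ : m ∈ Q := ⟨⟨by rw [hτm]; positivity, by rw [hτm]; nlinarith⟩, by rw [hνm]; exact hρ.le⟩
  set κ := (u b - u a) / len with hκ
  have hκl : κ * len = u b - u a := by rw [hκ]; field_simp
  obtain ⟨B, hB⟩ := hQc.bddAbove_image hcont
  have hB' : ∀ y ∈ Q, u y ≤ B := fun y hy => hB ⟨y, hy, rfl⟩
  -- The concave bump `ε τ (len - τ)` is then at most `γ / 2`, so `u - φ` is at least `γ / 2` at
  -- `m`. On the end caps of the tube it is at most `γ / 4`.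
  set ε := γ / (2 * len ^ 2) with hε
  have hε0 : 0 < ε := by positivity
  have hεl : ε * len ^ 2 = γ / 2 := by rw [hε]; field_simp
  set A := (|B| + |u a| + |u b| + 1) / ρ ^ 2 with hA
  have hAρ : A * ρ ^ 2 = |B| + |u a| + |u b| + 1 := by rw [hA]; field_simp
  have hA0 : 0 ≤ A := by positivity
  let l : EuclideanSpace ℝ (Fin d) →L[ℝ] ℝ := (κ + ε * len) • innerSL ℝ e
  -- The linear interpolant along the axis, plus a steep convex term across the tube (which excludes
  -- the lateral boundary), plus a slightly concave term along the axis. The second derivative along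
  -- `e` is `-2 ε < 0`, which a subsolution forbids at an interior maximum of `u - φ`.
  let φ := quadTest (u a - l a) l A (-(A + ε)) a e
  have hφ : ∀ y, φ y = u a + κ * τ y + A * ν y ^ 2 + ε * (τ y * (len - τ y)) := fun y => by
    have h1 : l y = l a + (κ + ε * len) * τ y := by
      simp only [l, τ, _root_.smul_apply, innerSL_apply_apply, inner_sub_right,
        smul_eq_mul]
      ring
    simp only [φ, quadTest]
    rw [h1, hνsq]
    simp only [τ]
    ring
  have hφs : ContDiff ℝ 2 φ := contDiff_quadTest _ _ _ _ _ _
  obtain ⟨z, hz, hmax⟩ := hQc.exists_isMaxOn ⟨m, hmQ⟩ (hcont.sub hφs.continuous.continuousOn)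
  have hzval : γ / 2 ≤ u z - φ z := by
    have h1 : u m - φ m ≤ u z - φ z := hmax hmQ
    have h2 : φ m ≤ s * u a + t * u b + γ / 2 := by
      rw [hφ, hνm, hτm, ← hεl]
      have : ε * (t * len * (len - t * len)) ≤ ε * len ^ 2 := by
        refine mul_le_mul_of_nonneg_left ?_ hε0.le
        nlinarith [mul_nonneg ht ht, sq_nonneg len, mul_nonneg hs (sq_nonneg len),
          mul_nonneg (mul_nonneg ht ht) (sq_nonneg len)]
      have h5 : κ * (t * len) = t * (u b - u a) := by rw [← hκl]; ring
      rw [h5, show s = 1 - t by linarith]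
      linarith
    linarith
  obtain ⟨⟨hz0, hz1⟩, hz2⟩ := hz
  have hν0 : 0 ≤ ν z := norm_nonneg _
  have hz0' : 0 < τ z := by
    refine lt_of_le_of_ne hz0 fun h => ?_
    have h1 : u z ≤ u a + γ / 4 := by
      apply hBa
      have := hdist z
      rw [← h, zero_smul, add_zero] at this
      rw [Metric.mem_closedBall, this]
      exact hz2.trans ((min_le_right _ _).trans (min_le_left _ _))
    have h2 := hφ z
    rw [← h, zero_mul, mul_zero, mul_zero] at h2
    have h9 : 0 ≤ A * ν z ^ 2 := mul_nonneg hA0 (sq_nonneg _)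
    linarith
  have hz1' : τ z < len := by
    refine lt_of_le_of_ne hz1 fun h => ?_
    have h1 : u z ≤ u b + γ / 4 := by
      apply hBb
      have := hdist z
      rw [h, hle, add_sub_cancel] at this
      rw [Metric.mem_closedBall, this]
      exact hz2.trans ((min_le_right _ _).trans (min_le_right _ _))
    have h2 := hφ z
    rw [h, sub_self, mul_zero, mul_zero, hκl] at h2
    have h9 : 0 ≤ A * ν z ^ 2 := mul_nonneg hA0 (sq_nonneg _)
    linarith
  have hz2' : ν z < ρ := by
    refine lt_of_le_of_ne hz2 fun h => ?_
    have h2 := hφ z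
    rw [h, hAρ] at h2
    have h3 : -(|u a| + |u b|) ≤ u a + κ * τ z := by
      have h5 : κ * τ z = (τ z / len) * (u b - u a) := by rw [← hκl]; field_simp
      have h6 : 0 ≤ τ z / len := by positivity
      have h7 : τ z / len ≤ 1 := (div_le_one hl).2 hz1
      rw [h5]
      nlinarith [neg_abs_le (u a), neg_abs_le (u b), abs_nonneg (u a), abs_nonneg (u b)]
    have h4 : 0 ≤ ε * (τ z * (len - τ z)) :=
      mul_nonneg hε0.le (mul_nonneg hz0 (sub_nonneg.2 hz1))
    linarith [hB' z ⟨⟨hz0, hz1⟩, hz2⟩, le_abs_self B]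
  have hnhds : Q ∈ 𝓝 z := by
    have hopen : IsOpen {y | (0 < τ y ∧ τ y < len) ∧ ν y < ρ} :=
      ((isOpen_lt continuous_const hτc).inter (isOpen_lt hτc continuous_const)).inter
        (isOpen_lt hνc continuous_const)
    exact Filter.mem_of_superset (hopen.mem_nhds ⟨⟨hz0', hz1'⟩, hz2'⟩)
      fun y hy => ⟨⟨hy.1.1.le, hy.1.2.le⟩, hy.2.le⟩
  have h1 := hu.subsolution φ hφs.contDiffOn z (hQΩ ⟨⟨hz0, hz1⟩, hz2⟩) (hmax.isLocalMax hnhds)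
  have h2 := (le_min_iff.1 h1).2
  have h3 := lambdaOne_quadTest_le (u a - l a) l A (-(A + ε)) a e z e he he
  rw [real_inner_self_eq_norm_sq, he] at h3
  have : lambdaOne φ z ≤ 2 * A + 2 * -(A + ε) := h3.trans_eq (by ring)
  linarith

/-- The touching set of a supporting affine function at `x` contains `x` in the convex hull of its
intersection with the contact set. -/
lemma IsViscositySolution.mem_convexHull_contact (hu : IsViscositySolution Ω f u) (hd : 1 ≤ d)
    (hΩ : IsOpen Ω) (hbdd : Bornology.IsBounded Ω) (hf : ContinuousOn f (closure Ω))
    {x : EuclideanSpace ℝ (Fin d)} (hx : x ∈ Ω) (l : EuclideanSpace ℝ (Fin d) →L[ℝ] ℝ)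
    (hl : ∀ y ∈ closure Ω, u x + l (y - x) ≤ u y) :
    x ∈ convexHull ℝ {y | y ∈ closure Ω ∧ u y = u x + l (y - x) ∧ u y = f y} := by
  have huc := hu.continuousOn
  have hcomp : IsCompact (closure Ω) := hbdd.isCompact_closure
  have hlc : Continuous fun y => u x + l (y - x) := by fun_prop
  set D := {y | y ∈ closure Ω ∧ u y = u x + l (y - x) ∧ u y = f y} with hD
  have hGc : IsClosed {y | y ∈ closure Ω ∧ u y = f y} := by
    have := (huc.sub hf).preimage_isClosed_of_isClosed isClosed_closure (isClosed_singleton (x := 0))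
    convert! this using 1
    ext y; simp [sub_eq_zero]
  have hZc : IsClosed {y | y ∈ closure Ω ∧ u y = u x + l (y - x)} := by
    have := (huc.sub hlc.continuousOn).preimage_isClosed_of_isClosed isClosed_closure
      (isClosed_singleton (x := 0))
    convert! this using 1
    ext y; simp [sub_eq_zero]
  have hDc : IsCompact D := by
    refine hcomp.of_isClosed_subset ?_ fun y hy => hy.1
    convert! hGc.inter hZc using 1
    ext y
    simp only [hD, mem_ofPred_eq, mem_inter_iff]
    tauto
  by_contra hxD
  obtain ⟨g, s, hgD, hgx⟩ := geometric_hahn_banach_closed_point (convex_convexHull ℝ D)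
    (isCompact_convexHull_of_isCompact hDc).isClosed hxD
  have hgD' : ∀ y ∈ D, g y < s := fun y hy => hgD y (subset_convexHull ℝ D hy)
  -- tilt the supporting function
  obtain ⟨ε, hε, htilt⟩ : ∃ ε > 0, ∀ y ∈ closure Ω, u y = f y →
      0 ≤ u y - (u x + l (y - x)) - ε * (g y - s) := by
    set P := {y | y ∈ closure Ω ∧ u y = f y} ∩ {y | s ≤ g y} with hP
    have hPc : IsCompact P := hcomp.of_isClosed_subset
      (hGc.inter (isClosed_le continuous_const g.continuous)) fun y hy => hy.1.1
    have hneg : ∀ ε > 0, ∀ y ∈ closure Ω, g y < s →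
        0 ≤ u y - (u x + l (y - x)) - ε * (g y - s) := fun ε hε y hy h => by
      nlinarith [hl y hy, mul_pos hε (sub_pos.2 h)]
    rcases P.eq_empty_or_nonempty with hPe | hPn
    · refine ⟨1, one_pos, fun y hy hyf => hneg 1 one_pos y hy ?_⟩
      by_contra! h
      exact (hPe ▸ (⟨⟨hy, hyf⟩, h⟩ : y ∈ P) : y ∈ (∅ : Set _))
    · obtain ⟨p, hp, hpmin⟩ := hPc.exists_isMinOn hPn
        ((huc.sub hlc.continuousOn).mono fun y hy => hy.1.1)
      obtain ⟨q, hq, hqmax⟩ := hPc.exists_isMaxOn hPn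
        (f := fun y => g y - s) (by fun_prop)
      have hp0 : 0 < u p - (u x + l (p - x)) := by
        refine lt_of_le_of_ne (sub_nonneg.2 (hl p hp.1.1)) fun h => ?_
        exact absurd (hgD' p ⟨hp.1.1, by linarith, hp.1.2⟩) (not_lt.2 hp.2)
      have hq0 : 0 ≤ g q - s := sub_nonneg.2 hq.2
      refine ⟨(u p - (u x + l (p - x))) / (g q - s + 1), by positivity, fun y hy hyf => ?_⟩
      by_cases h : g y < s
      · exact hneg _ (by positivity) y hy h
      · have hyP : y ∈ P := ⟨⟨hy, hyf⟩, not_lt.1 h⟩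
        have h1 : u p - (u x + l (p - x)) ≤ u y - (u x + l (y - x)) := hpmin hyP
        have h2 : g y - s ≤ g q - s := hqmax hyP
        have h3 : (u p - (u x + l (p - x))) / (g q - s + 1) * (g y - s) ≤
            u p - (u x + l (p - x)) := by
          rw [div_mul_eq_mul_div, div_le_iff₀ (by linarith)]
          nlinarith
        linarith
  obtain ⟨R, hR⟩ := hcomp.isBounded.subset_closedBall x
  have hxc : x ∈ closure Ω := subset_closure hx
  have hR0 : 0 ≤ R := by simpa using hR hxc
  set μ := ε * (g x - s) / (2 * (R ^ 2 + 1)) with hμ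
  have hgx' : 0 < ε * (g x - s) := mul_pos hε (sub_pos.2 hgx)
  have hμ0 : 0 < μ := by positivity
  have hμR : ∀ y ∈ closure Ω, μ * ‖y - x‖ ^ 2 < ε * (g x - s) := fun y hy => by
    have h1 : ‖y - x‖ ≤ R := by simpa [dist_eq_norm] using hR hy
    have h2 : ‖y - x‖ ^ 2 ≤ R ^ 2 := pow_le_pow_left₀ (norm_nonneg _) h1 2
    have h3 : μ * (2 * (R ^ 2 + 1)) = ε * (g x - s) := by rw [hμ]; field_simp
    nlinarith
  -- Tilting towards the side of `x` keeps the affine function below `u` on the contact set and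
  -- lifts it above `u` at `x`. The term `μ ‖y - x‖ ^ 2` is too small to undo the gain and makes `φ`
  -- strictly convex. The minimum of `u - φ` is then off the contact set, hence inside `Ω`, and
  -- contradicts the supersolution property.
  let φ := quadTest (u x - l x - ε * s) (l + ε • g) μ 0 x (0 : EuclideanSpace ℝ (Fin d))
  have hφ : ∀ y, φ y = u x + l (y - x) + ε * (g y - s) + μ * ‖y - x‖ ^ 2 := fun y => by
    simp only [φ, quadTest, _root_.add_apply, _root_.smul_apply,
      smul_eq_mul, map_sub]
    ring
  have hφs : ContDiff ℝ 2 φ := contDiff_quadTest _ _ _ _ _ _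
  obtain ⟨z, hz, hmin⟩ := hcomp.exists_isMinOn ⟨x, hxc⟩ (huc.sub hφs.continuous.continuousOn)
  have h1 : u z - φ z ≤ -(ε * (g x - s)) := by
    have : u z - φ z ≤ u x - φ x := hmin hxc
    rw [hφ x] at this
    simpa using this
  have hzf : u z ≠ f z := fun h => by
    have h2 := htilt z hz h
    have h3 := hμR z hz
    rw [hφ z] at h1
    linarith
  have hzΩ : z ∈ Ω := by
    by_contra h
    exact hzf (hu.boundary z (by rw [hΩ.frontier_eq]; exact ⟨hz, h⟩))
  have hloc : IsLocalMin (fun y => u y - φ y) z :=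
    hmin.isLocalMin (Filter.mem_of_superset (hΩ.mem_nhds hzΩ) subset_closure)
  have h2 := hu.supersolution φ hφs.contDiffOn z hzΩ hloc
  have h3 : u z < f z := lt_of_le_of_ne (hu.le_obstacle hΩ hf hz) hzf
  have h4 := le_lambdaOne_quadTest hd (u x - l x - ε * s) (l + ε • g) μ x 0 z
  have h5 : 0 < min (f z - u z) (lambdaOne φ z) := lt_min (by linarith) (by
    have : 2 * μ ≤ lambdaOne φ z := h4
    linarith)
  linarith

end

/-! ### Supporting functions, Taylor expansions, and the contact-or-flat dichotomy. -/

section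

section Geometry

variable {E : Type*} [NormedAddCommGroup E] [InnerProductSpace ℝ E]

/-- A continuous convex function on an open convex set has a supporting affine function at every
point. -/
lemma exists_supporting {Ω : Set E} {u : E → ℝ} (hΩ : IsOpen Ω) (hu : ConvexOn ℝ Ω u)
    (huc : ContinuousOn u Ω) {x : E} (hx : x ∈ Ω) :
    ∃ l : E →L[ℝ] ℝ, ∀ y ∈ Ω, u x + l (y - x) ≤ u y := by
  have hS : IsOpen {p : E × ℝ | p.1 ∈ Ω ∧ u p.1 < p.2} := by
    rw [isOpen_iff_mem_nhds]
    rintro ⟨y, t⟩ ⟨hy, hyt⟩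
    have h1 : ContinuousAt (fun p : E × ℝ => u p.1) (y, t) :=
      (huc.continuousAt (hΩ.mem_nhds hy)).comp (f := Prod.fst) continuousAt_fst
    exact Filter.Eventually.and ((hΩ.preimage continuous_fst).mem_nhds hy)
      (h1.eventually_lt continuousAt_snd hyt)
  obtain ⟨F, hF⟩ := geometric_hahn_banach_open_point hu.convex_strict_epigraph hS
    (x := (x, u x)) (fun h => lt_irrefl _ h.2)
  set c := F (0, 1) with hc
  have hsplit : ∀ y t, F (y, t) = F (y, 0) + t * c := fun y t => by
    have : ((y, t) : E × ℝ) = (y, 0) + t • (0, 1) := by simp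
    rw [this, map_add, map_smul, smul_eq_mul]
  -- The vertical component is nonzero because the point `(x, u x + 1)` above `(x, u x)` is strictly
  -- separated from it. Dividing by it turns the hyperplane into a graph.
  have hc0 : c < 0 := by
    have := hF (x, u x + 1) ⟨hx, by simp⟩
    rw [hsplit x (u x + 1), hsplit x (u x)] at this
    linarith
  refine ⟨(-c)⁻¹ • F.comp (ContinuousLinearMap.inl ℝ E ℝ), fun y hy => ?_⟩
  have h1 : F (y, 0) + u y * c ≤ F (x, 0) + u x * c := by
    rw [← hsplit x]
    refine le_of_forall_pos_le_add fun ε hε => ?_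
    have := hF (y, u y + ε / (-c)) ⟨hy, by
      have : 0 < ε / (-c) := div_pos hε (by linarith)
      simpa using this⟩
    rw [hsplit y] at this
    have h2 : ε / (-c) * c = -ε := by field_simp [hc0.ne]
    rw [add_mul, h2] at this
    linarith
  have h2 : F (y - x, 0) = F (y, 0) - F (x, 0) := by
    rw [← map_sub]; simp
  have h3 : ((-c)⁻¹ • F.comp (ContinuousLinearMap.inl ℝ E ℝ)) (y - x) =
      (-c)⁻¹ * (F (y, 0) - F (x, 0)) := by
    rw [← h2]; simp
  rw [h3, ← le_sub_iff_add_le', inv_mul_le_iff₀ (by linarith)]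
  linarith

/-- Closure points are reached by contracting a whole configuration towards an interior point: this
preserves affine relations, does not increase distances, and moves everything into `Ω`, where the
Taylor bounds hold. Letting the parameter tend to 0 then uses only continuity on the closure. -/
lemma lineMap_mem_of_mem_closure {Ω : Set E} (hΩ : IsOpen Ω) (hconv : Convex ℝ Ω) {x y : E}
    (hx : x ∈ closure Ω) (hy : y ∈ Ω) {t : ℝ} (ht : t ∈ Ioc (0 : ℝ) 1) :
    AffineMap.lineMap x y t ∈ Ω := by
  rw [AffineMap.lineMap_apply_module]
  have := hconv.combo_closure_interior_mem_interior hx (hΩ.interior_eq.symm ▸ hy)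
    (sub_nonneg.2 ht.2) ht.1 (by ring)
  rwa [hΩ.interior_eq] at this

lemma continuousOn_comp_lineMap {Ω : Set E} (hΩ : IsOpen Ω) (hconv : Convex ℝ Ω) {w : E → ℝ}
    (hw : ContinuousOn w (closure Ω)) {x y : E} (hx : x ∈ closure Ω) (hy : y ∈ Ω) :
    ContinuousOn (fun t : ℝ => w (AffineMap.lineMap x y t)) (closure (Ioc 0 1)) := by
  rw [closure_Ioc zero_ne_one]
  refine hw.comp AffineMap.lineMap_continuous.continuousOn fun t ht => ?_
  rcases ht.1.eq_or_lt with rfl | h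
  · simpa using hx
  · exact subset_closure (lineMap_mem_of_mem_closure hΩ hconv hx hy ⟨h, ht.2⟩)

lemma zero_mem_closure_Ioc : (0 : ℝ) ∈ closure (Ioc (0 : ℝ) 1) := by
  rw [closure_Ioc zero_ne_one]; simp

lemma convexOn_closure {Ω : Set E} {u : E → ℝ} (hΩ : IsOpen Ω) (hne : Ω.Nonempty)
    (hu : ConvexOn ℝ Ω u) (huc : ContinuousOn u (closure Ω)) : ConvexOn ℝ (closure Ω) u := by
  refine ⟨hu.1.closure, fun a ha b hb s t hs ht hst => ?_⟩
  obtain ⟨x0, hx0⟩ := hne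
  have hm : s • a + t • b ∈ closure Ω := hu.1.closure ha hb hs ht hst
  have h := le_on_closure (s := Ioc (0 : ℝ) 1)
    (f := fun r => u (AffineMap.lineMap (s • a + t • b) x0 r))
    (g := fun r => s * u (AffineMap.lineMap a x0 r) + t * u (AffineMap.lineMap b x0 r))
    (fun r hr => ?_) (continuousOn_comp_lineMap hΩ hu.1 huc hm hx0)
    ((continuousOn_const.mul (continuousOn_comp_lineMap hΩ hu.1 huc ha hx0)).add
      (continuousOn_const.mul (continuousOn_comp_lineMap hΩ hu.1 huc hb hx0)))
    zero_mem_closure_Ioc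
  · simpa using h
  · have h1 := hu.2 (lineMap_mem_of_mem_closure hΩ hu.1 ha hx0 hr)
      (lineMap_mem_of_mem_closure hΩ hu.1 hb hx0 hr) hs ht hst
    have h2 : AffineMap.lineMap (s • a + t • b) x0 r =
        s • AffineMap.lineMap a x0 r + t • AffineMap.lineMap b x0 r := by
      simp only [AffineMap.lineMap_apply_module]
      rw [show s = 1 - t by linarith]
      module
    simp only [h2]
    simpa using h1

/-- `w` has a Taylor expansion of order `k` with remainder `H |y - x| ^ β`, uniformly on `Ω`. -/
def HasTaylor (k : ℕ) (β H : ℝ) (Ω : Set E) (w : E → ℝ) (g : E → E →L[ℝ] ℝ) : Prop :=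
  (k = 0 → ∀ x, g x = 0) ∧ (k = 1 → ∀ x ∈ Ω, HasFDerivAt w (g x) x) ∧
    ∀ x ∈ Ω, ∀ y ∈ Ω, |w y - w x - g x (y - x)| ≤ H * dist y x ^ β

lemma HasTaylor.le_of_mem_closure {k : ℕ} {β H : ℝ} {Ω : Set E} {w : E → ℝ} {g : E → E →L[ℝ] ℝ}
    (h : HasTaylor k β H Ω w g) (hβ : 0 < β) (hw : ContinuousOn w (closure Ω)) {x y : E}
    (hx : x ∈ Ω) (hy : y ∈ closure Ω) : w y ≤ w x + g x (y - x) + H * dist y x ^ β := by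
  refine le_on_closure (s := Ω) (f := w) (g := fun y => w x + g x (y - x) + H * dist y x ^ β)
    (fun z hz => ?_) hw ?_ hy
  · have := (abs_le.1 (h.2.2 x hx z hz)).2
    linarith
  · refine Continuous.continuousOn ?_
    have h1 : Continuous fun y => dist y x ^ β :=
      (continuous_id.dist continuous_const).rpow_const fun _ => Or.inr hβ.le
    fun_prop

/-- The interpolation error of a function of class `C^{k,α}` is at most `H h ^ β`. -/
lemma HasTaylor.sum_le {k : ℕ} {β H h : ℝ} {Ω : Set E} {w : E → ℝ} {g : E → E →L[ℝ] ℝ}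
    (hT : HasTaylor k β H Ω w g) (hβ : 0 < β) (hH : 0 ≤ H) (hΩ : IsOpen Ω) (hconv : Convex ℝ Ω)
    (hne : Ω.Nonempty) (hw : ContinuousOn w (closure Ω)) {ι : Type*} (s : Finset ι) (c : ι → ℝ)
    (p : ι → E) (hc : ∀ i ∈ s, 0 ≤ c i) (hc1 : ∑ i ∈ s, c i = 1) (hp : ∀ i ∈ s, p i ∈ closure Ω)
    {x : E} (hx : ∑ i ∈ s, c i • p i = x) (hd : ∀ i ∈ s, dist (p i) x ≤ h) :
    ∑ i ∈ s, c i * w (p i) ≤ w x + H * h ^ β := by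
  obtain ⟨x0, hx0⟩ := hne
  have hxc : x ∈ closure Ω := hx ▸ hconv.closure.sum_mem hc hc1 hp
  have h := le_on_closure (s := Ioc (0 : ℝ) 1)
    (f := fun r => ∑ i ∈ s, c i * w (AffineMap.lineMap (p i) x0 r))
    (g := fun r => w (AffineMap.lineMap x x0 r) + H * h ^ β) (fun r hr => ?_)
    (continuousOn_finsetSum s fun i hi => continuousOn_const.mul
      (continuousOn_comp_lineMap hΩ hconv hw (hp i hi) hx0))
    ((continuousOn_comp_lineMap hΩ hconv hw hxc hx0).add continuousOn_const)
    zero_mem_closure_Ioc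
  · simpa using h
  set q : E := AffineMap.lineMap x x0 r with hq
  have hqΩ : q ∈ Ω := lineMap_mem_of_mem_closure hΩ hconv hxc hx0 hr
  have hdiff : ∀ i, AffineMap.lineMap (p i) x0 r - q = (1 - r) • (p i - x) := fun i => by
    rw [hq, AffineMap.lineMap_apply_module, AffineMap.lineMap_apply_module]; module
  have h1 : ∀ i ∈ s, c i * w (AffineMap.lineMap (p i) x0 r) ≤
      c i * (w q + H * h ^ β) + g q ((1 - r) • (c i • p i - c i • x)) := fun i hi => by
    have h2 := hT.le_of_mem_closure hβ hw hqΩ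
      (subset_closure (lineMap_mem_of_mem_closure hΩ hconv (hp i hi) hx0 hr))
    have h3 : dist (AffineMap.lineMap (p i) x0 r) q ≤ h := by
      rw [dist_eq_norm, hdiff, norm_smul, Real.norm_of_nonneg (sub_nonneg.2 hr.2)]
      have h4 := hd i hi
      rw [dist_eq_norm] at h4
      nlinarith [norm_nonneg (p i - x), hr.1]
    have h5 : H * dist (AffineMap.lineMap (p i) x0 r) q ^ β ≤ H * h ^ β :=
      mul_le_mul_of_nonneg_left (Real.rpow_le_rpow dist_nonneg h3 hβ.le) hH
    rw [hdiff] at h2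
    have h6 : g q ((1 - r) • (c i • p i - c i • x)) = c i * g q ((1 - r) • (p i - x)) := by
      rw [← smul_sub, smul_comm, map_smul, smul_eq_mul]
    rw [h6, ← mul_add]
    exact mul_le_mul_of_nonneg_left (by linarith) (hc i hi)
  -- The first-order terms cancel, since `∑ c i • (p i - x) = 0`.
  refine (Finset.sum_le_sum h1).trans ?_
  rw [Finset.sum_add_distrib, ← Finset.sum_mul, hc1, one_mul, ← map_sum, ← Finset.smul_sum,
    Finset.sum_sub_distrib, hx, ← Finset.sum_smul, hc1, one_smul, sub_self, smul_zero, map_zero,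
    add_zero]

/-- At a point where an affine function touches from below, the derivative is determined. -/
lemma HasFDerivAt.eq_of_supporting {Ω : Set E} {w : E → ℝ} {G l : E →L[ℝ] ℝ} {p : E}
    (hG : HasFDerivAt w G p) (hΩ : IsOpen Ω) (hp : p ∈ Ω) (h : ∀ y ∈ Ω, w p + l (y - p) ≤ w y) :
    G = l := by
  have hmin : IsLocalMin (fun y => w y - l y) p := by
    filter_upwards [hΩ.mem_nhds hp] with y hy
    have := h y hy
    rw [map_sub] at this
    linarith
  exact sub_eq_zero.1 (hmin.hasFDerivAt_eq_zero (hG.sub l.hasFDerivAt))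

/-- Two ordered functions of class `C^{k,α}` separate slowly near a contact point. -/
lemma HasTaylor.sub_le_of_contact {k : ℕ} (hk : k = 0 ∨ k = 1) {β F N : ℝ} {Ω : Set E}
    {f u : E → ℝ} {gf gu : E → E →L[ℝ] ℝ} (hf : HasTaylor k β F Ω f gf)
    (hu : HasTaylor k β N Ω u gu) (hΩ : IsOpen Ω) (hle : ∀ y ∈ Ω, u y ≤ f y) {p x : E}
    (hp : p ∈ Ω) (hx : x ∈ Ω) (hpe : u p = f p) : f x - u x ≤ (N + F) * dist p x ^ β := by
  -- For `k = 1` the nonnegative function `f - u` has a minimum at `p`, so its gradient vanishes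
  -- there.
  have hg : gf p = gu p := by
    rcases hk with rfl | rfl
    · rw [hf.1 rfl, hu.1 rfl]
    · have := HasFDerivAt.eq_of_supporting ((hf.2.1 rfl p hp).sub (hu.2.1 rfl p hp)) hΩ hp
        (l := 0) (fun y hy => by simpa [hpe] using hle y hy)
      exact sub_eq_zero.1 this
  have h1 := (abs_le.1 (hf.2.2 p hp x hx)).2
  have h2 := (abs_le.1 (hu.2.2 p hp x hx)).1
  rw [dist_comm p x]
  rw [hg] at h1
  linarith

/-- The second difference of `u` is small in directions close to a direction in which `u` is
affine. -/
lemma HasTaylor.secondDiff_le_of_flat {k : ℕ} (hk : k = 0 ∨ k = 1) {β N : ℝ} {Ω : Set E}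
    {u : E → ℝ} {g : E → E →L[ℝ] ℝ} (hT : HasTaylor k β N Ω u g) (hβ : 0 < β) (hN : 0 ≤ N)
    (hΩ : IsOpen Ω) (hu : ConvexOn ℝ (closure Ω) u) (hconv : Convex ℝ Ω)
    (huc : ContinuousOn u (closure Ω)) {x z w : E} (hx : x ∈ Ω) {l : E →L[ℝ] ℝ}
    (hl : ∀ y ∈ closure Ω, u x + l (y - x) ≤ u y) {η : ℝ} (hη : ‖w - z‖ ≤ η)
    (hz1 : x + z ∈ closure Ω) (hz2 : x - z ∈ closure Ω)
    (huz1 : u (x + z) = u x + l z) (huz2 : u (x - z) = u x - l z)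
    (hw1 : x + w ∈ closure Ω) (hw2 : x - w ∈ closure Ω) :
    u (x + w) + u (x - w) - 2 * u x ≤ 2 * N * η ^ β := by
  have h := le_on_closure (s := Ioc (0 : ℝ) 1)
    (f := fun r => u (AffineMap.lineMap (x + w) x r) + u (AffineMap.lineMap (x - w) x r))
    (g := fun r => 2 * u x + 2 * N * η ^ β) (fun r hr => ?_)
    ((continuousOn_comp_lineMap hΩ hconv huc hw1 hx).add
      (continuousOn_comp_lineMap hΩ hconv huc hw2 hx))
    continuousOn_const zero_mem_closure_Ioc
  · simp only [AffineMap.lineMap_apply_zero] at h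
    linarith
  -- The supporting function at `x` also touches `u` at the ends of the flat segment, so for `k = 1`
  -- both end gradients equal `l`, and for `k = 0` both are 0. Expanding about the two ends, the
  -- terms `± G (w - z)` cancel and only two remainders `N η^β` are left.
  have key : ∀ ζ ω : E, ‖ω - ζ‖ ≤ η → x + ζ ∈ closure Ω → u (x + ζ) = u x + l ζ →
      x + ω ∈ closure Ω → ∃ G : E →L[ℝ] ℝ, (k = 0 → G = 0) ∧ (k = 1 → G = l) ∧
        u (AffineMap.lineMap (x + ω) x r) ≤
          u x + (1 - r) * l ζ + (1 - r) * G (ω - ζ) + N * η ^ β := by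
    intro ζ ω hζω hζ huζ hω
    set p : E := AffineMap.lineMap (x + ζ) x r with hp
    have hpΩ : p ∈ Ω := lineMap_mem_of_mem_closure hΩ hconv hζ hx hr
    have hpx : p = x + (1 - r) • ζ := by rw [hp, AffineMap.lineMap_apply_module]; module
    have hup : u p = u x + (1 - r) * l ζ := by
      apply le_antisymm
      · have := hu.2 hζ (subset_closure hx) (sub_nonneg.2 hr.2) hr.1.le (by ring)
        rw [hp, AffineMap.lineMap_apply_module]
        refine this.trans_eq ?_
        rw [huζ, smul_eq_mul, smul_eq_mul]; ring
      · have := hl p (subset_closure hpΩ)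
        rwa [hpx, add_sub_cancel_left, map_smul, smul_eq_mul, ← hpx] at this
    refine ⟨g p, fun h => hT.1 h p, fun h => ?_, ?_⟩
    · refine HasFDerivAt.eq_of_supporting (hT.2.1 h p hpΩ) hΩ hpΩ fun y hy => ?_
      have h1 := hl y (subset_closure hy)
      have h2 : l (y - p) = l (y - x) - (1 - r) * l ζ := by
        rw [hpx, ← smul_eq_mul, ← map_smul, ← map_sub]; congr 1; abel
      rw [h2, hup]
      linarith
    · set q : E := AffineMap.lineMap (x + ω) x r with hq
      have hqΩ : q ∈ Ω := lineMap_mem_of_mem_closure hΩ hconv hω hx hr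
      have hqp : q - p = (1 - r) • (ω - ζ) := by
        rw [hpx, hq, AffineMap.lineMap_apply_module]; module
      have h1 := (abs_le.1 (hT.2.2 p hpΩ q hqΩ)).2
      have h2 : dist q p ≤ η := by
        rw [dist_eq_norm, hqp, norm_smul, Real.norm_of_nonneg (sub_nonneg.2 hr.2)]
        nlinarith [norm_nonneg (ω - ζ), hr.1]
      have h3 : N * dist q p ^ β ≤ N * η ^ β :=
        mul_le_mul_of_nonneg_left (Real.rpow_le_rpow dist_nonneg h2 hβ.le) hN
      rw [hqp, map_smul, smul_eq_mul, hup] at h1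
      linarith
  obtain ⟨G1, hG10, hG11, h1⟩ := key z w hη hz1 huz1 hw1
  obtain ⟨G2, hG20, hG21, h2⟩ := key (-z) (-w) (by rwa [neg_sub_neg, norm_sub_rev])
    (by rwa [← sub_eq_add_neg]) (by rw [← sub_eq_add_neg, huz2, map_neg, sub_eq_add_neg])
    (by rwa [← sub_eq_add_neg])
  have hG : G1 = G2 := by
    rcases hk with h | h
    · rw [hG10 h, hG20 h]
    · rw [hG11 h, hG21 h]
  rw [← sub_eq_add_neg] at h2
  have h3 : G2 (-w - -z) = -G1 (w - z) := by rw [hG, ← map_neg]; congr 1; abel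
  rw [h3, map_neg] at h2
  linarith

end Geometry

variable {d : ℕ}

/-- For `k = 0` this is the Hölder bound with zero gradient. For `k = 1` the mean value inequality
is applied on `Ω` intersected with the ball of radius `dist y x` about `x`, where the gradient
oscillates by at most the seminorm times `dist y x ^ α`. Both cases then run with the single
exponent `k + α`. -/
lemma IsHolderClass.exists_hasTaylor {k : ℕ} (hk : k = 0 ∨ k = 1) {α : ℝ≥0}
    {Ω : Set (EuclideanSpace ℝ (Fin d))} (hΩ : IsOpen Ω) (hconv : Convex ℝ Ω)
    {w : EuclideanSpace ℝ (Fin d) → ℝ} (hw : IsHolderClass k α Ω w) :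
    ∃ g, HasTaylor k (k + α) (holderSeminorm k α Ω w) Ω w g := by
  have hH := hw.holder.holderWith
  rcases hk with rfl | rfl
  · refine ⟨fun _ => 0, fun _ _ => rfl, fun h => absurd h (by norm_num), fun x hx y hy => ?_⟩
    have h1 := hH.dist_le ⟨y, hy⟩ ⟨x, hx⟩
    simp only [domRestrict_apply, iteratedFDeriv_zero_eq_comp, Function.comp_apply,
      LinearIsometryEquiv.dist_map] at h1
    simpa [holderSeminorm, Real.dist_eq, iteratedFDeriv_zero_eq_comp, Subtype.dist_eq] using h1
  · refine ⟨fderiv ℝ w, fun h => absurd h (by norm_num), fun _ x hx => ?_, fun x hx y hy => ?_⟩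
    · exact ((hw.contDiffOn.differentiableOn (by norm_num)).differentiableAt
        (hΩ.mem_nhds hx)).hasFDerivAt
    · have hb : ∀ z ∈ Ω, ‖fderiv ℝ w z - fderiv ℝ w x‖ ≤
          holderSeminorm 1 α Ω w * dist z x ^ (α : ℝ) := by
        intro z hz
        have h1 := hH.dist_le ⟨z, hz⟩ ⟨x, hx⟩
        refine ContinuousLinearMap.opNorm_le_bound _ (mul_nonneg (NNReal.coe_nonneg _) (by positivity)) fun v => ?_
        have h2 := (iteratedFDeriv ℝ 1 w z - iteratedFDeriv ℝ 1 w x).le_opNorm ![v]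
        simp only [domRestrict_apply, dist_eq_norm] at h1
        have h3 : (iteratedFDeriv ℝ 1 w z - iteratedFDeriv ℝ 1 w x) ![v] =
            (fderiv ℝ w z - fderiv ℝ w x) v := by
          simp [iteratedFDeriv_one_apply]
        rw [h3] at h2
        refine h2.trans ?_
        simp only [Finset.univ_unique, Finset.prod_singleton]
        exact mul_le_mul_of_nonneg_right (by rw [dist_eq_norm]; exact h1) (norm_nonneg _)
      have hs : Convex ℝ (Ω ∩ Metric.closedBall x (dist y x)) :=
        hconv.inter (convex_closedBall x _)
      have h1 := hs.norm_image_sub_le_of_norm_hasFDerivWithin_le' (f := w) (f' := fderiv ℝ w)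
        (φ := fderiv ℝ w x) (C := holderSeminorm 1 α Ω w * dist y x ^ (α : ℝ))
        (x := x) (y := y) (fun z hz => (((hw.contDiffOn.differentiableOn
          (by norm_num)).differentiableAt (hΩ.mem_nhds hz.1)).hasFDerivAt).hasFDerivWithinAt)
        (fun z hz => (hb z hz.1).trans (mul_le_mul_of_nonneg_left
          (Real.rpow_le_rpow dist_nonneg hz.2 (NNReal.coe_nonneg _)) (NNReal.coe_nonneg _)))
        ⟨hx, Metric.mem_closedBall_self dist_nonneg⟩ ⟨hy, by simp⟩
      rw [Real.norm_eq_abs, ← dist_eq_norm] at h1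
      refine h1.trans_eq ?_
      rcases (dist_nonneg (x := y) (y := x)).eq_or_lt with h0 | h0
      · have h2 : ((1 : ℕ) : ℝ) + α ≠ 0 := by positivity
        rw [← h0, Real.zero_rpow h2]; simp
      · rw [Nat.cast_one, Real.rpow_add h0, Real.rpow_one]; ring

/-- Either the contact set is near `x`, or `u` is affine on a segment centered at `x`. -/
lemma IsViscositySolution.exists_contact_or_flat {Ω : Set (EuclideanSpace ℝ (Fin d))}
    {f u : EuclideanSpace ℝ (Fin d) → ℝ} (hu : IsViscositySolution Ω f u) (hd : 1 ≤ d)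
    (hΩ : IsOpen Ω) (hconv : Convex ℝ Ω) (hbdd : Bornology.IsBounded Ω)
    (hf : ContinuousOn f (closure Ω))
    {x : EuclideanSpace ℝ (Fin d)} (hx : x ∈ Ω) {l : EuclideanSpace ℝ (Fin d) →L[ℝ] ℝ}
    (hl : ∀ y ∈ closure Ω, u x + l (y - x) ≤ u y) {s : ℝ} (hs : 0 < s) :
    (∃ p ∈ closure Ω, u p = f p ∧ dist p x < d * s) ∨
      ∃ v : EuclideanSpace ℝ (Fin d), ‖v‖ = 1 ∧ x + s • v ∈ closure Ω ∧ x - s • v ∈ closure Ω ∧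
        u (x + s • v) = u x + l (s • v) ∧ u (x - s • v) = u x - l (s • v) := by
  by_cases hnear : ∃ p ∈ closure Ω, u p = f p ∧ dist p x < d * s
  · exact Or.inl hnear
  right
  push Not at hnear
  have hucv : ConvexOn ℝ (closure Ω) u :=
    convexOn_closure hΩ ⟨x, hx⟩ (hu.convexOn hΩ hconv) hu.continuousOn
  obtain ⟨ι, _, z, w, hz, hind, hw, hw1, hxz⟩ := eq_pos_convex_span_of_mem_convexHull
    (hu.mem_convexHull_contact hd hΩ hbdd hf hx l hl)
  have hz' : ∀ i, z i ∈ closure Ω ∧ u (z i) = u x + l (z i - x) ∧ u (z i) = f (z i) :=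
    fun i => hz ⟨i, rfl⟩
  have hcard : Fintype.card ι ≤ d + 1 := by
    refine hind.card_le_finrank_succ.trans (Nat.succ_le_succ ((Submodule.finrank_le _).trans ?_))
    simp
  have hne : (Finset.univ : Finset ι).Nonempty := by
    by_contra h
    rw [Finset.not_nonempty_iff_eq_empty] at h
    rw [h] at hw1
    simp at hw1
  obtain ⟨i, -, hi⟩ := Finset.exists_max_image Finset.univ w hne
  -- The largest of at most `d + 1` weights is at least `1 / (d + 1)`. This is the source of the
  -- factor `d` in the contact distance.
  have hwi : 1 ≤ (d + 1) * w i := by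
    have h1 : ∑ j, w j ≤ Finset.univ.card • w i := Finset.sum_le_card_nsmul _ _ _ hi
    rw [hw1, nsmul_eq_mul, Finset.card_univ] at h1
    have h2 : (Fintype.card ι : ℝ) ≤ d + 1 := by exact_mod_cast hcard
    nlinarith [hw i]
  have hd' : (1 : ℝ) ≤ d := by exact_mod_cast hd
  have hdist : d * s ≤ ‖z i - x‖ := by
    rw [← dist_eq_norm]; exact hnear _ (hz' i).1 (hz' i).2.2
  have hpos : 0 < ‖z i - x‖ := lt_of_lt_of_le (by positivity) hdist
  set a := s / ‖z i - x‖ with ha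
  have ha0 : 0 < a := by positivity
  have had : d * a ≤ 1 := by
    rw [ha, ← mul_div_assoc]; exact (div_le_one hpos).2 hdist
  have ha1 : a ≤ 1 := by nlinarith
  set v := ‖z i - x‖⁻¹ • (z i - x) with hv
  have hsv : s • v = a • (z i - x) := by rw [hv, smul_smul, ha, div_eq_mul_inv]
  have hxc : x ∈ closure Ω := subset_closure hx
  -- the touching set is convex
  have hZ : ∀ y ∈ convexHull ℝ {y | y ∈ closure Ω ∧ u y = u x + l (y - x)},
      y ∈ closure Ω ∧ u y = u x + l (y - x) := by
    have hconvZ : Convex ℝ {y | y ∈ closure Ω ∧ u y = u x + l (y - x)} := by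
      rintro y ⟨hy, hyu⟩ y' ⟨hy', hyu'⟩ b c hb hc hbc
      have hm := hconv.closure hy hy' hb hc hbc
      refine ⟨hm, le_antisymm ?_ (hl _ hm)⟩
      have := hucv.2 hy hy' hb hc hbc
      refine this.trans_eq ?_
      rw [hyu, hyu', smul_eq_mul, smul_eq_mul, map_sub, map_sub, map_sub, map_add, map_smul,
        map_smul, smul_eq_mul, smul_eq_mul, show b = 1 - c by linarith]
      ring
    intro y hy
    rwa [hconvZ.convexHull_eq] at hy
  have hzZ : ∀ j, z j ∈ convexHull ℝ {y | y ∈ closure Ω ∧ u y = u x + l (y - x)} :=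
    fun j => subset_convexHull ℝ _ ⟨(hz' j).1, (hz' j).2.1⟩
  have h1 : x + s • v ∈ convexHull ℝ {y | y ∈ closure Ω ∧ u y = u x + l (y - x)} := by
    have hxZ : x ∈ convexHull ℝ {y | y ∈ closure Ω ∧ u y = u x + l (y - x)} :=
      subset_convexHull ℝ _ ⟨hxc, by simp⟩
    have := convex_convexHull ℝ _ hxZ (hzZ i) (sub_nonneg.2 ha1) ha0.le (by ring)
    convert! this using 1
    rw [hsv]; module
  -- The reflected point has weights `(1 + a) w j`, lowered by `a` at `j = i`. The `i`-th one stays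
  -- nonnegative because `a ≤ 1 / d` and `w i ≥ 1 / (d + 1)`.
  have h2 : x - s • v ∈ convexHull ℝ {y | y ∈ closure Ω ∧ u y = u x + l (y - x)} := by
    classical
    have := (convex_convexHull ℝ {y | y ∈ closure Ω ∧ u y = u x + l (y - x)}).sum_mem
      (t := Finset.univ) (w := fun j => (1 + a) * w j - if j = i then a else 0) (z := z)
      (fun j _ => ?_) ?_ (fun j _ => hzZ j)
    · convert! this using 1
      simp only [sub_smul, mul_smul, ite_smul, zero_smul]
      rw [Finset.sum_sub_distrib, ← Finset.smul_sum, hxz, Finset.sum_ite_eq', if_pos (Finset.mem_univ _),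
        hsv]
      module
    · by_cases hji : j = i
      · subst hji
        simp only [if_true]
        nlinarith [hw j]
      · simp only [if_neg hji, sub_zero]
        have := hw j
        positivity
    · rw [Finset.sum_sub_distrib, ← Finset.mul_sum, hw1, Finset.sum_ite_eq',
        if_pos (Finset.mem_univ _)]
      ring
  have h1' := hZ _ h1
  have h2' := hZ _ h2
  refine ⟨v, ?_, h1'.1, h2'.1, ?_, ?_⟩
  · rw [hv, norm_smul, norm_inv, norm_norm, inv_mul_cancel₀ hpos.ne']
  · rw [h1'.2]; simp
  · rw [h2'.2, sub_sub_cancel_left, map_neg, sub_eq_add_neg]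

end

/-! ### The distance to the complement of a convex open set, and heights of simplices. -/

section

section Geometry

variable {E : Type*} [NormedAddCommGroup E] [InnerProductSpace ℝ E]

/-- The orthogonal projection of `y` onto the supporting hyperplane through `z` lies outside `U`. -/
lemma infDist_compl_le_inner {U : Set E} {z n : E} (hn : ‖n‖ = 1)
    (hU : ∀ y ∈ U, 0 < (inner ℝ n (y - z) : ℝ)) {y : E} (hy : y ∈ closure U) :
    Metric.infDist y Uᶜ ≤ inner ℝ n (y - z) := by
  have h0 : 0 ≤ (inner ℝ n (y - z) : ℝ) :=
    le_on_closure (s := U) (f := fun _ => (0 : ℝ)) (g := fun y => (inner ℝ n (y - z) : ℝ))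
      (fun x hx => (hU x hx).le) continuousOn_const (by fun_prop) hy
  have hmem : y - (inner ℝ n (y - z) : ℝ) • n ∈ Uᶜ := fun h => by
    have := hU _ h
    rw [sub_right_comm, inner_sub_right, inner_smul_right, real_inner_self_eq_norm_sq, hn] at this
    simp at this
  refine (Metric.infDist_le_dist_of_mem hmem).trans_eq ?_
  rw [dist_eq_norm, sub_sub_cancel, norm_smul, hn, Real.norm_of_nonneg h0, mul_one]

lemma affineMap_apply_sum {ι : Type*} (A : E →ᵃ[ℝ] ℝ) (s : Finset ι) (c : ι → ℝ) (p : ι → E)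
    (hc : ∑ i ∈ s, c i = 1) : A (∑ i ∈ s, c i • p i) = ∑ i ∈ s, c i * A (p i) := by
  have h : ∀ y, A y = A.linear y + A 0 := fun y => congrFun A.decomp y
  rw [h, map_sum]
  simp only [h (p _), mul_add, Finset.sum_add_distrib, ← Finset.sum_mul, hc, one_mul, map_smul,
    smul_eq_mul]

/-- The height of a simplex over a face is at least the diameter of any inscribed ball. -/
lemma le_dist_of_mem_convexHull_erase [DecidableEq E] {T : Finset E}
    (hT : AffineIndependent ℝ ((↑) : T → E)) (hspan : affineSpan ℝ (T : Set E) = ⊤) {x y : E}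
    (hx : x ∈ T) (hy : y ∈ convexHull ℝ ((T.erase x : Finset E) : Set E)) {ρ : ℝ} (hρ : 0 ≤ ρ) {c : E}
    (hc : Metric.closedBall c (ρ / 2) ⊆ convexHull ℝ (T : Set E)) : ρ ≤ dist x y := by
  let b : AffineBasis T ℝ E := ⟨(↑), hT, by simpa using hspan⟩
  let A : E →ᵃ[ℝ] ℝ := b.coord ⟨x, hx⟩
  have hrange : range b = (T : Set E) := by
    change range ((↑) : T → E) = _
    simp
  have hA : ∀ w ∈ convexHull ℝ (T : Set E), 0 ≤ A w ∧ A w ≤ 1 := by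
    intro w hw
    rw [← hrange, b.convexHull_eq_nonneg_coord] at hw
    refine ⟨hw _, ?_⟩
    rw [← b.sum_coord_apply_eq_one w]
    exact Finset.single_le_sum (f := fun i => b.coord i w) (fun i _ => hw i) (Finset.mem_univ _)
  have hAx : A x = 1 := b.coord_apply_eq ⟨x, hx⟩
  have hAy : A y = 0 := by
    have hconv : Convex ℝ (A ⁻¹' {0}) := (convex_singleton (0 : ℝ)).affine_preimage A
    refine convexHull_min (fun p hp => ?_) hconv hy
    have hp' := Finset.mem_erase.1 hp
    exact b.coord_apply_ne (i := ⟨x, hx⟩) (j := ⟨p, hp'.2⟩) fun h => hp'.1 (congrArg Subtype.val h).symm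
  have hxy : 0 < dist x y := by
    refine dist_pos.2 fun h => ?_
    rw [h, hAy] at hAx
    exact zero_ne_one hAx
  have hL : A.linear (x - y) = 1 := by
    have := A.linearMap_vsub x y
    rw [hAx, hAy] at this
    simpa using this
  -- The barycentric coordinate of `x` grows by 1 from `y` to `x`, hence by `ρ / dist x y` along the
  -- parallel diameter of the ball. It ranges in `[0, 1]` on the simplex.
  set w := (ρ / 2 / dist x y) • (x - y) with hw
  have hwn : ‖w‖ = ρ / 2 := by
    rw [hw, norm_smul, ← dist_eq_norm, Real.norm_of_nonneg (by positivity)]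
    field_simp
  have hLw : A.linear w = ρ / 2 / dist x y := by rw [hw, map_smul, hL, smul_eq_mul, mul_one]
  have h1 := (hA (c + w) (hc (by simp [hwn]))).2
  have h2 := (hA (c - w) (hc (by simp [hwn]))).1
  have h3 : A (c + w) = A.linear w + A c := by
    rw [add_comm]
    exact A.map_vadd c w
  have h4 : A (c - w) = -A.linear w + A c := by
    rw [← map_neg, sub_eq_add_neg, add_comm]
    exact A.map_vadd c (-w)
  rw [h3] at h1
  rw [h4] at h2
  have h5 : 2 * (ρ / 2 / dist x y) ≤ 1 := by rw [← hLw]; linarith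
  rw [← mul_div_assoc, div_le_one hxy] at h5
  linarith

variable [FiniteDimensional ℝ E]

/-- The distance to the complement of a convex open set is attained along an inner normal. -/
lemma exists_inner_normal {U : Set E} (hU : IsOpen U) (hconv : Convex ℝ U) (hne : U.Nonempty)
    (huniv : U ≠ univ) (x : E) :
    ∃ z n : E, ‖n‖ = 1 ∧ (∀ y ∈ U, 0 < (inner ℝ n (y - z) : ℝ)) ∧
      Metric.infDist x Uᶜ = dist x z ∧ Metric.infDist x Uᶜ ≤ inner ℝ n (x - z) := by
  obtain ⟨z, hz, hxz⟩ := hU.isClosed_compl.exists_infDist_eq_dist (nonempty_compl.2 huniv) x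
  obtain ⟨g, hg⟩ := geometric_hahn_banach_point_open hconv hU hz
  set G : E := (InnerProductSpace.toDual ℝ E).symm g with hG
  have hgG : ∀ y, (inner ℝ G y : ℝ) = g y := fun y => by
    rw [hG, InnerProductSpace.toDual_symm_apply]
  have hG0 : 0 < ‖G‖ := by
    obtain ⟨y, hy⟩ := hne
    rw [norm_pos_iff]
    intro h
    have h1 := hg y hy
    rw [← hgG, ← hgG, h, inner_zero_left, inner_zero_left] at h1
    exact lt_irrefl _ h1
  have hn : ‖(‖G‖⁻¹ • G)‖ = 1 := by
    rw [norm_smul, norm_inv, norm_norm, inv_mul_cancel₀ hG0.ne']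
  have hpos : ∀ y ∈ U, 0 < (inner ℝ (‖G‖⁻¹ • G) (y - z) : ℝ) := fun y hy => by
    rw [real_inner_smul_left, hgG, map_sub]
    exact mul_pos (inv_pos.2 hG0) (sub_pos.2 (hg y hy))
  refine ⟨z, _, hn, hpos, hxz, ?_⟩
  rcases Metric.infDist_nonneg (x := x) (s := Uᶜ) |>.eq_or_lt with h0 | h0
  · have : x = z := by rw [← h0] at hxz; exact dist_eq_zero.1 hxz.symm
    rw [← h0, this]; simp
  -- Moving from `x` against the normal by `t` less than the distance stays inside `U`, where the
  -- half-space inequality is available.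
  · refine le_of_forall_lt fun t ht => ?_
    by_cases ht0 : 0 ≤ t
    · have hmem : x - t • (‖G‖⁻¹ • G) ∈ U := by
        by_contra h
        have := Metric.infDist_le_dist_of_mem (x := x) (s := Uᶜ) h
        rw [dist_eq_norm, sub_sub_cancel, norm_smul, hn, Real.norm_of_nonneg ht0, mul_one] at this
        linarith
      have := hpos _ hmem
      rw [sub_right_comm, inner_sub_right, inner_smul_right, real_inner_self_eq_norm_sq, hn] at this
      linarith
    · have hmem : x ∈ U := by
        by_contra h
        rw [Metric.infDist_zero_of_mem (show x ∈ Uᶜ from h)] at h0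
        exact lt_irrefl _ h0
      linarith [hpos x hmem]

/-- At every point a supporting hyperplane provides an affine majorant of the distance whose value
at that point is at most the distance there. -/
lemma concaveOn_infDist_compl {U : Set E} (hU : IsOpen U) (hconv : Convex ℝ U) (hne : U.Nonempty)
    (huniv : U ≠ univ) : ConcaveOn ℝ (closure U) fun y => Metric.infDist y Uᶜ := by
  refine ⟨hconv.closure, fun a ha b hb s t hs ht hst => ?_⟩
  obtain ⟨z, n, hn, hpos, hz, hle⟩ := exists_inner_normal hU hconv hne huniv (s • a + t • b)
  have h1 := infDist_compl_le_inner hn hpos ha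
  have h2 := infDist_compl_le_inner hn hpos hb
  have h3 : (inner ℝ n (s • a + t • b - z) : ℝ) ≤ dist (s • a + t • b) z := by
    have := real_inner_le_norm n (s • a + t • b - z)
    rwa [hn, one_mul, ← dist_eq_norm] at this
  have h4 : (inner ℝ n (s • a + t • b - z) : ℝ) =
      s * inner ℝ n (a - z) + t * inner ℝ n (b - z) := by
    rw [← inner_smul_right, ← inner_smul_right, ← inner_add_right]
    congr 1
    rw [show s = 1 - t by linarith]; module
  simp only [smul_eq_mul]
  rw [hz]
  nlinarith

lemma infDist_frontier_eq {U : Set E} (hU : IsOpen U) (huniv : U ≠ univ) {x : E} (hx : x ∈ U) :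
    Metric.infDist x (frontier U) = Metric.infDist x Uᶜ := by
  obtain ⟨y, hy, hxy⟩ := exists_mem_frontier_infDist_compl_eq_dist hx huniv
  refine le_antisymm ?_ ?_
  · rw [hxy]; exact Metric.infDist_le_dist_of_mem hy
  · refine Metric.infDist_le_infDist_of_subset (fun z hz => ?_) ⟨y, hy⟩
    rw [hU.frontier_eq] at hz
    exact hz.2

end Geometry

variable {d : ℕ} {Ω : Set (EuclideanSpace ℝ (Fin d))} {σ : ℝ}
  {K : Geometry.SimplicialComplex ℝ (EuclideanSpace ℝ (Fin d))}

/-! ### Geometry of the mesh: node-to-boundary distances and boundary nodes. -/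

namespace IsMesh

lemma exists_element (hK : IsMesh Ω σ K) {x : EuclideanSpace ℝ (Fin d)} (hx : x ∈ K.space) :
    ∃ T ∈ elements K, x ∈ convexHull ℝ (T : Set (EuclideanSpace ℝ (Fin d))) := by
  obtain ⟨s, hs, hxs⟩ := Geometry.SimplicialComplex.mem_space_iff.1 hx
  obtain ⟨T, hT, hsT⟩ := hK.pure s hs
  exact ⟨T, hT, convexHull_mono (Finset.coe_subset.2 hsT) hxs⟩

lemma finite_elements (hK : IsMesh Ω σ K) : (elements K).Finite := hK.finite.subset fun _ h => h.1

lemma nonempty_elements (hK : IsMesh Ω σ K) : (elements K).Nonempty := by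
  obtain ⟨s, hs⟩ := hK.nonempty
  obtain ⟨T, hT, -⟩ := hK.pure s hs
  exact ⟨T, hT⟩

lemma isCompact_space (hK : IsMesh Ω σ K) : IsCompact K.space :=
  hK.finite.isCompact_biUnion fun s _ => s.finite_toSet.isCompact_convexHull ℝ

lemma affineSpan_eq_top {T : Finset (EuclideanSpace ℝ (Fin d))} (hT : T ∈ elements K) :
    affineSpan ℝ (T : Set (EuclideanSpace ℝ (Fin d))) = ⊤ := by
  have h := (K.indep hT.1).affineSpan_eq_top_iff_card_eq_finrank_add_one.2 (by simp [hT.2])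
  simpa using h

lemma nonempty_meshDomain (hK : IsMesh Ω σ K) : (meshDomain K).Nonempty := by
  obtain ⟨T, hT⟩ := hK.nonempty_elements
  refine (interior_convexHull_nonempty_iff_affineSpan_eq_top.2 (affineSpan_eq_top hT)).mono ?_
  exact interior_mono (K.convexHull_subset_space hT.1)

lemma isOpen_meshDomain : IsOpen (meshDomain K) := isOpen_interior

lemma convex_meshDomain (hK : IsMesh Ω σ K) : Convex ℝ (meshDomain K) := hK.convex.interior

lemma closure_meshDomain (hK : IsMesh Ω σ K) : closure (meshDomain K) = K.space := by
  rw [meshDomain, hK.convex.closure_interior_eq_closure_of_nonempty_interior hK.nonempty_meshDomain,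
    hK.isCompact_space.isClosed.closure_eq]

lemma meshDomain_subset (hK : IsMesh Ω σ K) (hΩ : IsOpen Ω) (hconv : Convex ℝ Ω)
    (hne : Ω.Nonempty) : meshDomain K ⊆ Ω := by
  have h : interior (closure Ω) = Ω := by
    rw [hconv.interior_closure_eq_interior_of_nonempty_interior (hΩ.interior_eq.symm ▸ hne),
      hΩ.interior_eq]
  rw [← h]
  exact interior_mono hK.subset

lemma meshDomain_ne_univ (hK : IsMesh Ω σ K) (hd : 1 ≤ d) : meshDomain K ≠ univ := by
  intro h
  have h1 : K.space = univ := by rw [← hK.closure_meshDomain, h, closure_univ]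
  have : Nonempty (Fin d) := ⟨⟨0, hd⟩⟩
  exact noncompact_univ (EuclideanSpace ℝ (Fin d)) (h1 ▸ hK.isCompact_space)

lemma vertices_finite (hK : IsMesh Ω σ K) : K.vertices.Finite := by
  rw [Geometry.SimplicialComplex.vertices_eq]
  exact hK.finite.biUnion fun s _ => s.finite_toSet

lemma mem_vertices_of_mem {T : Finset (EuclideanSpace ℝ (Fin d))} (hT : T ∈ elements K)
    {p : EuclideanSpace ℝ (Fin d)} (hp : p ∈ T) : p ∈ K.vertices := by
  rw [Geometry.SimplicialComplex.vertices_eq]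
  exact mem_biUnion hT.1 hp

lemma elementDiam_le_meshSize (hK : IsMesh Ω σ K) {T : Finset (EuclideanSpace ℝ (Fin d))}
    (hT : T ∈ elements K) : elementDiam T ≤ meshSize K :=
  le_csSup (hK.finite_elements.image _).bddAbove ⟨T, hT, rfl⟩

lemma dist_le_meshSize (hK : IsMesh Ω σ K) {T : Finset (EuclideanSpace ℝ (Fin d))}
    (hT : T ∈ elements K) {x y : EuclideanSpace ℝ (Fin d)}
    (hx : x ∈ convexHull ℝ (T : Set (EuclideanSpace ℝ (Fin d))))
    (hy : y ∈ convexHull ℝ (T : Set (EuclideanSpace ℝ (Fin d)))) : dist x y ≤ meshSize K :=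
  (Metric.dist_le_diam_of_mem (T.finite_toSet.isCompact_convexHull ℝ).isBounded hx hy).trans
    (hK.elementDiam_le_meshSize hT)

lemma elementDiam_pos (hd : 1 ≤ d) {T : Finset (EuclideanSpace ℝ (Fin d))}
    (hT : T ∈ elements K) : 0 < elementDiam T := by
  have h1 : 1 < T.card := by rw [hT.2]; omega
  obtain ⟨a, ha, b, hb, hab⟩ := Finset.one_lt_card.1 h1
  exact (dist_pos.2 hab).trans_le (Metric.dist_le_diam_of_mem
    (T.finite_toSet.isCompact_convexHull ℝ).isBounded (subset_convexHull ℝ _ ha)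
    (subset_convexHull ℝ _ hb))

lemma meshSize_pos (hK : IsMesh Ω σ K) (hd : 1 ≤ d) : 0 < meshSize K := by
  obtain ⟨T, hT⟩ := hK.nonempty_elements
  exact (elementDiam_pos hd hT).trans_le (hK.elementDiam_le_meshSize hT)

lemma one_le_sigma (hK : IsMesh Ω σ K) (hd : 1 ≤ d) : 1 ≤ σ := by
  obtain ⟨T, hT⟩ := hK.nonempty_elements
  have h1 := elementDiam_pos hd hT
  have h2 := (hK.elementDiam_le_meshSize hT).trans (hK.quasiUniform T hT)
  nlinarith

lemma mem_meshDomain_of_interiorNode (hK : IsMesh Ω σ K) {x : EuclideanSpace ℝ (Fin d)}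
    (hx : x ∈ interiorNodes Ω K) : x ∈ meshDomain K := by
  have h1 : x ∈ closure (meshDomain K) :=
    hK.closure_meshDomain ▸ K.vertices_subset_space hx.1
  by_contra h
  exact hx.2 ⟨hx.1, hK.boundary x hx.1 (by rw [isOpen_meshDomain.frontier_eq]; exact ⟨h1, h⟩)⟩

/-- The distance of an interior node to the boundary is bounded below by a multiple of the mesh
size. -/
lemma meshSize_le_dist (hK : IsMesh Ω σ K) (hd : 1 ≤ d) {x z : EuclideanSpace ℝ (Fin d)}
    (hxv : x ∈ K.vertices) (hx : x ∈ meshDomain K) (hz : z ∈ K.space) (hz' : z ∉ meshDomain K) :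
    meshSize K ≤ σ ^ 2 * dist x z := by
  classical
  have hσ := hK.one_le_sigma hd
  -- an element containing the first part of the segment
  set B := ⋃ T ∈ {T ∈ elements K | x ∉ convexHull ℝ (T : Set (EuclideanSpace ℝ (Fin d)))},
    convexHull ℝ (T : Set (EuclideanSpace ℝ (Fin d))) with hB
  have hBc : IsClosed B := (hK.finite_elements.subset fun _ h => h.1).isClosed_biUnion
    fun T _ => T.finite_toSet.isClosed_convexHull ℝ
  have hxB : x ∈ Bᶜ := by
    simp only [hB, mem_compl_iff, mem_iUnion, not_exists]
    exact fun T hT hxT => hT.2 hxT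
  have hev : ∀ᶠ t in 𝓝[>] (0 : ℝ), AffineMap.lineMap x z t ∈ Bᶜ := by
    have hc : ContinuousAt (fun t : ℝ => (AffineMap.lineMap x z t : EuclideanSpace ℝ (Fin d))) 0 :=
      AffineMap.lineMap_continuous.continuousAt
    refine (hc.eventually_mem ?_).filter_mono nhdsWithin_le_nhds
    simpa using hBc.isOpen_compl.mem_nhds hxB
  obtain ⟨t, ht, ht0, ht1⟩ := (hev.and (Ioc_mem_nhdsGT one_pos)).exists
  set y' : EuclideanSpace ℝ (Fin d) := AffineMap.lineMap x z t with hy'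
  have hxs : x ∈ K.space := K.vertices_subset_space hxv
  have hy's : y' ∈ K.space := hK.convex.segment_subset hxs hz (by
    rw [segment_eq_image_lineMap]; exact ⟨t, ⟨ht0.le, ht1⟩, rfl⟩)
  obtain ⟨T, hT, hyT⟩ := hK.exists_element hy's
  have hxTc : x ∈ convexHull ℝ (T : Set (EuclideanSpace ℝ (Fin d))) := by
    by_contra h
    exact ht (mem_biUnion (show T ∈ {T ∈ elements K | _} from ⟨hT, h⟩) hyT)
  have hxT : x ∈ T := by
    simpa using (K.vertex_mem_convexHull_iff hxv hT.1).1 hxTc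
  have hne : ((T.erase x : Finset _) : Set (EuclideanSpace ℝ (Fin d))).Nonempty := by
    rw [Finset.coe_nonempty, ← Finset.card_pos, Finset.card_erase_of_mem hxT, hT.2]
    omega
  -- The ray from `x` towards `z` starts in an element having `x` as a vertex and meets the opposite
  -- face at `y`. The height of the element bounds `dist x y` from below by a multiple of `h`.
  obtain ⟨y, hy, hy'y⟩ : ∃ y ∈ convexHull ℝ ((T.erase x : Finset _) :
      Set (EuclideanSpace ℝ (Fin d))), y' ∈ segment ℝ x y := by
    rw [← Finset.insert_erase hxT, Finset.coe_insert, convexHull_insert hne] at hyT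
    simpa [mem_convexJoin] using hyT
  have hρ : elementDiam T ≤ σ * dist x y := by
    refine (hK.shapeRegular T hT).trans (mul_le_mul_of_nonneg_left ?_ (by linarith))
    refine Real.sSup_le ?_ dist_nonneg
    rintro ρ ⟨hρ0, c, hc⟩
    exact le_dist_of_mem_convexHull_erase (K.indep hT.1) (affineSpan_eq_top hT) hxT hy hρ0 hc
  have hh : meshSize K ≤ σ ^ 2 * dist x y := by
    refine (hK.quasiUniform T hT).trans ?_
    nlinarith
  refine hh.trans (mul_le_mul_of_nonneg_left ?_ (sq_nonneg σ))
  rw [segment_eq_image_lineMap] at hy'y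
  obtain ⟨a, ⟨ha0, ha1⟩, hay⟩ := hy'y
  have hvec : a • (y - x) = t • (z - x) := by
    have h1 : AffineMap.lineMap x y a = (AffineMap.lineMap x z t : EuclideanSpace ℝ (Fin d)) := hay
    rw [AffineMap.lineMap_apply_module', AffineMap.lineMap_apply_module'] at h1
    exact add_right_cancel h1
  -- Either `z` is at least as far along the ray as `y`, or it lies strictly between the interior
  -- point `x` and `y`, which by convexity puts it inside the mesh domain.
  rcases le_or_gt t a with hta | hat
  · have h1 : a * dist x y = t * dist x z := by
      have := congrArg norm hvec
      rwa [norm_smul, norm_smul, Real.norm_of_nonneg ha0, Real.norm_of_nonneg ht0.le,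
        ← dist_eq_norm, ← dist_eq_norm, dist_comm y, dist_comm z] at this
    by_contra! h
    nlinarith [dist_nonneg (x := x) (y := y)]
  · exfalso
    refine hz' ?_
    have hys : y ∈ K.space := K.convexHull_subset_space hT.1
      (convexHull_mono (Finset.coe_subset.2 (Finset.erase_subset _ _)) hy)
    have ha0' : 0 < a := by
      refine lt_of_le_of_ne ha0 fun h => ?_
      rw [← h, zero_smul] at hvec
      have hzx : z = x := sub_eq_zero.1 ((smul_eq_zero.1 hvec.symm).resolve_left ht0.ne')
      exact hz' (hzx ▸ hx)
    have hseg : z ∈ openSegment ℝ x y := by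
      refine ⟨1 - a / t, a / t, ?_, by positivity, by ring, ?_⟩
      · rw [sub_pos, div_lt_one ht0]; exact hat
      · have h1 : (a / t) • (y - x) = z - x := by
          rw [div_eq_inv_mul, mul_smul, hvec, smul_smul, inv_mul_cancel₀ ht0.ne', one_smul]
        have h2 : (1 - a / t) • x + (a / t) • y = x + (a / t) • (y - x) := by module
        rw [h2, h1]; abel
    exact hK.convex.openSegment_interior_self_subset_interior hx hys hseg

lemma meshSize_le_infDist (hK : IsMesh Ω σ K) (hd : 1 ≤ d) {x : EuclideanSpace ℝ (Fin d)}
    (hx : x ∈ interiorNodes Ω K) :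
    meshSize K ≤ σ ^ 2 * Metric.infDist x (meshDomain K)ᶜ := by
  obtain ⟨z, hz, hxz⟩ := exists_mem_frontier_infDist_compl_eq_dist
    (hK.mem_meshDomain_of_interiorNode hx) (hK.meshDomain_ne_univ hd)
  rw [isOpen_meshDomain.frontier_eq, hK.closure_meshDomain] at hz
  rw [hxz]
  exact hK.meshSize_le_dist hd hx.1 (hK.mem_meshDomain_of_interiorNode hx) hz.1 hz.2

/-- Every boundary point of the mesh domain is within the mesh size of a boundary node. -/
lemma exists_boundaryNode (hK : IsMesh Ω σ K) {z : EuclideanSpace ℝ (Fin d)} (hz : z ∈ K.space)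
    (hz' : z ∉ meshDomain K) : ∃ p ∈ boundaryNodes Ω K, dist p z ≤ meshSize K := by
  -- A functional supporting the mesh domain at `z` is at least as large at some vertex of an
  -- element containing `z`, so that vertex is on the boundary too.
  obtain ⟨g, hg⟩ := geometric_hahn_banach_open_point hK.convex_meshDomain isOpen_meshDomain hz'
  obtain ⟨T, hT, hzT⟩ := hK.exists_element hz
  obtain ⟨p, hp, hgp⟩ : ∃ p ∈ T, g z ≤ g p := by
    by_contra! h
    have hconv : Convex ℝ {y | g y < g z} := convex_halfSpace_lt g.toLinearMap.isLinear _
    have : z ∈ {y | g y < g z} := convexHull_min (fun p hp => h p hp) hconv hzT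
    exact lt_irrefl (g z) this
  have hpv := mem_vertices_of_mem hT hp
  refine ⟨p, ⟨hpv, hK.boundary p hpv ?_⟩, hK.dist_le_meshSize hT (subset_convexHull ℝ _ hp) hzT⟩
  rw [isOpen_meshDomain.frontier_eq, hK.closure_meshDomain]
  exact ⟨K.vertices_subset_space hpv, fun h => (hg p h).not_ge hgp⟩

end IsMesh

/-- Values of piecewise linear functions are convex combinations of nodal values. -/
lemma IsPiecewiseLinear.exists_weights (hK : IsMesh Ω σ K) {x : EuclideanSpace ℝ (Fin d)}
    (hx : x ∈ K.space) : ∃ (T : Finset (EuclideanSpace ℝ (Fin d)))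
      (c : EuclideanSpace ℝ (Fin d) → ℝ), (∀ p ∈ T, p ∈ K.vertices) ∧ (∀ p ∈ T, 0 ≤ c p) ∧
        ∑ p ∈ T, c p = 1 ∧ ∑ p ∈ T, c p • p = x ∧ (∀ p ∈ T, dist p x ≤ meshSize K) ∧
        ∀ w, IsPiecewiseLinear K w → w x = ∑ p ∈ T, c p * w p := by
  obtain ⟨T, hT, hxT⟩ := hK.exists_element hx
  obtain ⟨c, hc, hc1, hcx⟩ := Finset.mem_convexHull'.1 hxT
  refine ⟨T, c, fun p hp => IsMesh.mem_vertices_of_mem hT hp, hc, hc1, hcx,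
    fun p hp => hK.dist_le_meshSize hT (subset_convexHull ℝ _ hp) hxT, fun w hw => ?_⟩
  obtain ⟨A, hA⟩ := hw.affine T hT
  rw [hA hxT, ← hcx, affineMap_apply_sum A T c (fun p => p) hc1]
  exact Finset.sum_congr rfl fun p hp => by rw [hA (subset_convexHull ℝ _ hp)]

end

/-! ### Discrete comparison from below and from above. -/

section

variable {d : ℕ} {Ω : Set (EuclideanSpace ℝ (Fin d))} {σ δ θ : ℝ}
  {K : Geometry.SimplicialComplex ℝ (EuclideanSpace ℝ (Fin d))}
  {S : Finset (EuclideanSpace ℝ (Fin d))} {f u uε b : EuclideanSpace ℝ (Fin d) → ℝ}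

lemma IsSphereDiscretization.nonempty (hS : IsSphereDiscretization θ S) (hd : 1 ≤ d) :
    S.Nonempty := by
  have : Nonempty (Fin d) := ⟨⟨0, hd⟩⟩
  obtain ⟨v, hv⟩ := NormedSpace.sphere_nonempty (E := EuclideanSpace ℝ (Fin d)) (x := 0)
    |>.2 zero_le_one
  obtain ⟨w, hw, -⟩ := hS.approx v (by simpa using hv)
  exact ⟨w, hw⟩

lemma IsMesh.stepSize_eq (hK : IsMesh Ω σ K) (hd : 1 ≤ d) {x : EuclideanSpace ℝ (Fin d)}
    (hx : x ∈ interiorNodes Ω K) :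
    stepSize K δ x = min δ (Metric.infDist x (meshDomain K)ᶜ) := by
  rw [stepSize, infDist_frontier_eq IsMesh.isOpen_meshDomain (hK.meshDomain_ne_univ hd)
    (hK.mem_meshDomain_of_interiorNode hx)]

lemma IsMesh.infDist_pos (hK : IsMesh Ω σ K) (hd : 1 ≤ d) {x : EuclideanSpace ℝ (Fin d)}
    (hx : x ∈ interiorNodes Ω K) : 0 < Metric.infDist x (meshDomain K)ᶜ := by
  have h1 := hK.meshSize_le_infDist hd hx
  have h2 := hK.meshSize_pos hd
  by_contra! h
  nlinarith [sq_nonneg σ]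

lemma IsMesh.stepSize_pos (hK : IsMesh Ω σ K) (hd : 1 ≤ d) (hδ : 0 < δ)
    {x : EuclideanSpace ℝ (Fin d)} (hx : x ∈ interiorNodes Ω K) : 0 < stepSize K δ x := by
  rw [hK.stepSize_eq hd hx]
  exact lt_min hδ (hK.infDist_pos hd hx)

lemma IsMesh.add_mem_space (hK : IsMesh Ω σ K) (hd : 1 ≤ d) {x w : EuclideanSpace ℝ (Fin d)}
    (hx : x ∈ interiorNodes Ω K) (hw : ‖w‖ ≤ stepSize K δ x) : x + w ∈ K.space := by
  have hpos := hK.infDist_pos hd hx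
  have hball : Metric.ball x (Metric.infDist x (meshDomain K)ᶜ) ⊆ meshDomain K := by
    intro y hy
    by_contra h
    have h1 := Metric.infDist_le_dist_of_mem (x := x) (s := (meshDomain K)ᶜ) h
    rw [Metric.mem_ball, dist_comm] at hy
    linarith
  rw [← hK.closure_meshDomain]
  refine closure_mono hball ?_
  rw [closure_ball x hpos.ne', Metric.mem_closedBall, dist_eq_norm, add_sub_cancel_left]
  refine hw.trans ?_
  rw [hK.stepSize_eq hd hx]
  exact min_le_right _ _

lemma IsMesh.add_smul_mem_space (hK : IsMesh Ω σ K) (hd : 1 ≤ d) (hδ : 0 < δ)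
    {x v : EuclideanSpace ℝ (Fin d)} (hx : x ∈ interiorNodes Ω K) (hv : ‖v‖ = 1) :
    x + stepSize K δ x • v ∈ K.space ∧ x - stepSize K δ x • v ∈ K.space := by
  have h : ‖stepSize K δ x • v‖ ≤ stepSize K δ x := by
    rw [norm_smul, hv, mul_one, Real.norm_of_nonneg (hK.stepSize_pos hd hδ hx).le]
  exact ⟨hK.add_mem_space hd hx h, by
    rw [sub_eq_add_neg]; exact hK.add_mem_space hd hx (by rwa [norm_neg])⟩

/-- The discrete solution lies below the obstacle and is discretely convex. -/
lemma IsDiscreteSolution.subsolution (h : IsDiscreteSolution Ω K δ S f uε)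
    {x : EuclideanSpace ℝ (Fin d)} (hx : x ∈ interiorNodes Ω K) :
    uε x ≤ f x ∧ ∀ v ∈ S, 0 ≤ secondDiff K δ uε x v := by
  have h0 := (h.interior x hx).ge
  rw [twoScaleOp, le_min_iff] at h0
  exact ⟨sub_nonneg.1 h0.1, fun v hv => h0.2.trans
    (ciInf_le (finite_range _).bddBelow (⟨v, hv⟩ : {v // v ∈ S}))⟩

lemma IsDiscreteSolution.supersolution (h : IsDiscreteSolution Ω K δ S f uε) (hS : S.Nonempty)
    {x : EuclideanSpace ℝ (Fin d)} (hx : x ∈ interiorNodes Ω K) :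
    uε x = f x ∨ ∃ v ∈ S, secondDiff K δ uε x v = 0 := by
  have h0 := h.interior x hx
  rw [twoScaleOp] at h0
  have : Nonempty {v // v ∈ S} := hS.to_subtype
  rcases min_choice (f x - uε x) (⨅ v : {v // v ∈ S}, secondDiff K δ uε x v.1) with h1 | h1
  · left; linarith
  · right
    obtain ⟨⟨v, hv⟩, hvi⟩ := exists_eq_ciInf_of_finite (f := fun v : {v // v ∈ S} =>
      secondDiff K δ uε x v.1)
    exact ⟨v, hv, hvi.trans (h1.symm.trans h0)⟩

/-- The discrete solution lies above the convex envelope. -/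
lemma IsDiscreteSolution.le_of_convexOn (h : IsDiscreteSolution Ω K δ S f uε) (hK : IsMesh Ω σ K)
    (hd : 1 ≤ d) (hδ : 0 < δ) (hS : IsSphereDiscretization θ S) (hu : ConvexOn ℝ (closure Ω) u)
    (huf : ∀ y ∈ closure Ω, u y ≤ f y) {x : EuclideanSpace ℝ (Fin d)} (hx : x ∈ K.space) :
    u x ≤ uε x := by
  obtain ⟨R, hR⟩ := hK.isCompact_space.isBounded.exists_norm_le
  have huK : ConvexOn ℝ K.space u := hu.subset hK.subset hK.convex
  have hnode : ∀ p ∈ K.vertices, u p ≤ uε p := by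
    intro p hp
    refine le_of_forall_pos_le_add fun η hη => ?_
    set μ := η / (R ^ 2 + 1) with hμ
    have hμ0 : 0 < μ := by positivity
    have hμR : μ * (R ^ 2 + 1) = η := by rw [hμ]; field_simp
    -- The quadratic term makes the second differences of `W` strictly positive while `W ≤ u` on the
    -- mesh. This excludes nodes where a discrete second difference vanishes.
    let W : EuclideanSpace ℝ (Fin d) → ℝ := fun y => u y + (μ * ‖y‖ ^ 2 - μ * R ^ 2)
    have hWc : ConvexOn ℝ K.space W := by
      have h1 : ConvexOn ℝ K.space fun y : EuclideanSpace ℝ (Fin d) => ‖y‖ ^ 2 :=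
        (convexOn_norm hK.convex).pow (fun _ _ => norm_nonneg _) 2
      exact huK.add (((h1.smul hμ0.le).congr fun y _ => by simp [smul_eq_mul]).sub
        (concaveOn_const (μ * R ^ 2) hK.convex))
    have hWu : ∀ y ∈ K.space, W y ≤ u y := fun y hy => by
      have h1 : ‖y‖ ^ 2 ≤ R ^ 2 := pow_le_pow_left₀ (norm_nonneg _) (hR y hy) 2
      have h2 := mul_le_mul_of_nonneg_left h1 hμ0.le
      simp only [W]; linarith
    obtain ⟨z, hz, hmin⟩ := exists_min_image K.vertices (fun y => uε y - W y) hK.vertices_finite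
      ⟨p, hp⟩
    have hzs := K.vertices_subset_space hz
    have key : 0 ≤ uε z - W z := by
      by_contra! hneg
      have hzu := hWu z hzs
      have hzΩ := hK.subset hzs
      by_cases hzb : z ∈ boundaryNodes Ω K
      · have h1 := h.boundary z hzb
        linarith [huf z hzΩ]
      have hzi : z ∈ interiorNodes Ω K := ⟨hz, hzb⟩
      rcases h.supersolution (hS.nonempty hd) hzi with h1 | ⟨v, hv, h1⟩
      · linarith [huf z hzΩ]
      have hs := hK.stepSize_pos hd hδ hzi
      have hvn := hS.norm_eq_one v hv
      obtain ⟨hm1, hm2⟩ := hK.add_smul_mem_space hd hδ hzi hvn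
      -- The points `z ± δ v` are generally not nodes. Convexity of `W` carries the nodal inequality
      -- to the interpolant there without loss.
      have hlow : ∀ y ∈ K.space, W y + (uε z - W z) ≤ uε y := by
        intro y hy
        obtain ⟨T, c, hT, hc, hc1, hcy, -, hw⟩ := IsPiecewiseLinear.exists_weights hK hy
        rw [hw uε h.piecewiseLinear]
        have h2 := hWc.map_sum_le hc hc1 fun q hq => K.vertices_subset_space (hT q hq)
        rw [hcy] at h2
        have h3 : ∑ q ∈ T, c q * (W q + (uε z - W z)) ≤ ∑ q ∈ T, c q * uε q :=
          Finset.sum_le_sum fun q hq => mul_le_mul_of_nonneg_left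
            (by linarith [hmin q (hT q hq)]) (hc q hq)
        simp only [mul_add, Finset.sum_add_distrib, ← Finset.sum_mul, hc1] at h3
        simp only [smul_eq_mul] at h2
        linarith
      have h2 := hlow _ hm1
      have h3 := hlow _ hm2
      rw [secondDiff, div_eq_zero_iff] at h1
      have h1 := h1.resolve_right (by positivity)
      have h4 : 2 * u z ≤ u (z + stepSize K δ z • v) + u (z - stepSize K δ z • v) := by
        have := huK.2 hm1 hm2 (by norm_num : (0 : ℝ) ≤ 1 / 2) (by norm_num : (0 : ℝ) ≤ 1 / 2)
          (by norm_num)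
        rw [← smul_add, add_add_sub_cancel, ← two_smul ℝ z, smul_smul] at this
        norm_num at this
        linarith
      have h5 : ‖z + stepSize K δ z • v‖ ^ 2 + ‖z - stepSize K δ z • v‖ ^ 2 =
          2 * ‖z‖ ^ 2 + 2 * stepSize K δ z ^ 2 := by
        have := parallelogram_law_with_norm ℝ z (stepSize K δ z • v)
        rw [norm_smul, hvn, mul_one, Real.norm_of_nonneg hs.le] at this
        nlinarith
      have h6 : 0 < μ * stepSize K δ z ^ 2 := by positivity
      have h7 := congrArg (fun t => μ * t) h5
      simp only [W, mul_add] at h2 h3 h7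
      linarith
    have h1 := hmin p hp
    have h2 : u p - η ≤ W p := by
      simp only [W]; nlinarith [mul_nonneg hμ0.le (sq_nonneg ‖p‖)]
    linarith
  obtain ⟨T, c, hT, hc, hc1, hcy, -, hw⟩ := IsPiecewiseLinear.exists_weights hK hx
  rw [hw uε h.piecewiseLinear]
  have h2 := huK.map_sum_le hc hc1 fun q hq => K.vertices_subset_space (hT q hq)
  rw [hcy] at h2
  exact h2.trans (Finset.sum_le_sum fun q hq =>
    mul_le_mul_of_nonneg_left (hnode q (hT q hq)) (hc q hq))

/-- Upper bound for the discrete solution by means of a concave barrier. -/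
lemma IsDiscreteSolution.le_of_barrier (h : IsDiscreteSolution Ω K δ S f uε) (hK : IsMesh Ω σ K)
    (hd : 1 ≤ d) (hδ : 0 < δ) (hS : IsSphereDiscretization θ S) {e M : ℝ} (hM : 0 ≤ M)
    (hI : ∀ (T : Finset (EuclideanSpace ℝ (Fin d))) (c : EuclideanSpace ℝ (Fin d) → ℝ)
      (x : EuclideanSpace ℝ (Fin d)), (∀ p ∈ T, p ∈ K.vertices) → (∀ p ∈ T, 0 ≤ c p) →
      ∑ p ∈ T, c p = 1 → ∑ p ∈ T, c p • p = x → (∀ p ∈ T, dist p x ≤ meshSize K) →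
      ∑ p ∈ T, c p * u p ≤ u x + e)
    (hb : ConcaveOn ℝ K.space b) (hb0 : ∀ y ∈ K.space, 0 ≤ b y)
    (huf : ∀ y ∈ frontier Ω, u y = f y)
    (hnode : ∀ x ∈ interiorNodes Ω K, f x ≤ u x + M ∨ ∃ v ∈ S,
      u (x + stepSize K δ x • v) + u (x - stepSize K δ x • v) - 2 * u x + 2 * e +
        (b (x + stepSize K δ x • v) + b (x - stepSize K δ x • v) - 2 * b x) < 0)
    {x : EuclideanSpace ℝ (Fin d)} (hx : x ∈ K.space) :
    uε x ≤ u x + e + b x + M := by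
  -- Interpolating `u` costs `e`, while interpolating the concave `b` costs nothing, so `b` needs no
  -- smoothness. The bound is applied with `m = M` and with the nodal maximum; in the latter case
  -- the two points `z ± δ v` account for the `2 * e` in `hnode`.
  have hup : ∀ m : ℝ, (∀ p ∈ K.vertices, uε p ≤ u p + b p + m) → ∀ y ∈ K.space,
      uε y ≤ u y + e + b y + m := by
    intro m hm y hy
    obtain ⟨T, c, hT, hc, hc1, hcy, hdist, hw⟩ := IsPiecewiseLinear.exists_weights hK hy
    rw [hw uε h.piecewiseLinear]
    have h1 := hI T c y hT hc hc1 hcy hdist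
    have h2 := hb.le_map_sum hc hc1 fun q hq => K.vertices_subset_space (hT q hq)
    rw [hcy] at h2
    have h3 : ∑ q ∈ T, c q * uε q ≤ ∑ q ∈ T, c q * (u q + b q + m) :=
      Finset.sum_le_sum fun q hq => mul_le_mul_of_nonneg_left (hm q (hT q hq)) (hc q hq)
    simp only [mul_add, Finset.sum_add_distrib, ← Finset.sum_mul, hc1] at h3
    simp only [smul_eq_mul] at h2
    linarith
  refine hup M (fun p hp => ?_) x hx
  obtain ⟨z, hz, hmax⟩ := exists_max_image K.vertices (fun y => uε y - u y - b y)
    hK.vertices_finite ⟨p, hp⟩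
  suffices uε z - u z - b z ≤ M by
    have := hmax p hp
    linarith
  have hzs := K.vertices_subset_space hz
  by_cases hzb : z ∈ boundaryNodes Ω K
  · linarith [h.boundary z hzb, huf z hzb.2, hb0 z hzs]
  have hzi : z ∈ interiorNodes Ω K := ⟨hz, hzb⟩
  obtain ⟨h1, h2⟩ := h.subsolution hzi
  rcases hnode z hzi with h3 | ⟨v, hv, h3⟩
  · linarith [hb0 z hzs]
  · exfalso
    have hs := hK.stepSize_pos hd hδ hzi
    obtain ⟨hm1, hm2⟩ := hK.add_smul_mem_space hd hδ hzi (hS.norm_eq_one v hv)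
    have hall := hup (uε z - u z - b z) fun q hq => by
      have := hmax q hq
      linarith
    have h4 := hall _ hm1
    have h5 := hall _ hm2
    have h6 := h2 v hv
    rw [secondDiff, le_div_iff₀ (by positivity), zero_mul] at h6
    linarith

end

/-! ### The barrier and its second differences. -/

section

section Barrier

variable {E : Type*} [NormedAddCommGroup E]

/-- The barrier: a concave paraboloid plus the square root of the truncated distance to the
boundary. -/
noncomputable def barrier (κ G R L : ℝ) (U : Set E) (y : E) : ℝ :=
  κ * (R ^ 2 - ‖y‖ ^ 2) + G * √(min (Metric.infDist y Uᶜ) L)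

lemma barrier_nonneg {κ G R L : ℝ} {U : Set E} {y : E} (hκ : 0 ≤ κ) (hG : 0 ≤ G) (hy : ‖y‖ ≤ R) :
    0 ≤ barrier κ G R L U y := by
  have : ‖y‖ ^ 2 ≤ R ^ 2 := pow_le_pow_left₀ (norm_nonneg _) hy 2
  exact add_nonneg (mul_nonneg hκ (sub_nonneg.2 this)) (mul_nonneg hG (Real.sqrt_nonneg _))

lemma barrier_le {κ G R L : ℝ} {U : Set E} {y : E} (hκ : 0 ≤ κ) (hG : 0 ≤ G) :
    barrier κ G R L U y ≤ κ * R ^ 2 + G * √L := by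
  refine add_le_add (mul_le_mul_of_nonneg_left ?_ hκ)
    (mul_le_mul_of_nonneg_left (Real.sqrt_le_sqrt (min_le_right _ _)) hG)
  linarith [sq_nonneg ‖y‖]

variable [InnerProductSpace ℝ E]

lemma secondDiff_nonpos_of_concaveOn {s : Set E} {b : E → ℝ} (hb : ConcaveOn ℝ s b) {x w : E}
    (h1 : x + w ∈ s) (h2 : x - w ∈ s) : b (x + w) + b (x - w) - 2 * b x ≤ 0 := by
  have := hb.2 h1 h2 (by norm_num : (0 : ℝ) ≤ 1 / 2) (by norm_num : (0 : ℝ) ≤ 1 / 2) (by norm_num)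
  have hmid : (1 / 2 : ℝ) • (x + w) + (1 / 2 : ℝ) • (x - w) = x := by module
  rw [hmid, smul_eq_mul, smul_eq_mul] at this
  linarith

lemma concaveOn_sqrt_truncated_infDist [FiniteDimensional ℝ E] {U : Set E} (hU : IsOpen U)
    (hconv : Convex ℝ U) (hne : U.Nonempty) (huniv : U ≠ univ) {L : ℝ} (hL : 0 ≤ L) :
    ConcaveOn ℝ (closure U) fun y => √(min (Metric.infDist y Uᶜ) L) := by
  have hD : ConcaveOn ℝ (closure U) fun y => min (Metric.infDist y Uᶜ) L :=
    (concaveOn_infDist_compl hU hconv hne huniv).inf (concaveOn_const L hconv.closure)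
  refine ⟨hconv.closure, fun x hx y hy s t hs ht hst => ?_⟩
  have h0 : ∀ z, (0 : ℝ) ≤ min (Metric.infDist z Uᶜ) L := fun z =>
    le_min Metric.infDist_nonneg hL
  exact (Real.strictConcaveOn_sqrt.concaveOn.2 (h0 x) (h0 y) hs ht hst).trans
    (Real.sqrt_le_sqrt (hD.2 hx hy hs ht hst))

lemma concaveOn_barrier [FiniteDimensional ℝ E] {U : Set E} (hU : IsOpen U)
    (hconv : Convex ℝ U) (hne : U.Nonempty) (huniv : U ≠ univ) {κ G R L : ℝ} (hκ : 0 ≤ κ)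
    (hG : 0 ≤ G) (hL : 0 ≤ L) : ConcaveOn ℝ (closure U) (barrier κ G R L U) := by
  have h1 : ConvexOn ℝ (closure U) fun y : E => ‖y‖ ^ 2 :=
    (convexOn_norm hconv.closure).pow (fun _ _ => norm_nonneg _) 2
  exact (((concaveOn_const (R ^ 2) hconv.closure).sub h1).smul hκ).add
    ((concaveOn_sqrt_truncated_infDist hU hconv hne huniv hL).smul hG)

lemma secondDiff_barrier (κ G R L : ℝ) (U : Set E) (x w : E) :
    barrier κ G R L U (x + w) + barrier κ G R L U (x - w) - 2 * barrier κ G R L U x =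
      -(2 * κ * ‖w‖ ^ 2) + G * (√(min (Metric.infDist (x + w) Uᶜ) L) +
        √(min (Metric.infDist (x - w) Uᶜ) L) - 2 * √(min (Metric.infDist x Uᶜ) L)) := by
  have h := parallelogram_law_with_norm ℝ x w
  have h' : ‖x + w‖ ^ 2 + ‖x - w‖ ^ 2 = 2 * ‖x‖ ^ 2 + 2 * ‖w‖ ^ 2 := by nlinarith
  have h2 := congrArg (fun t => κ * t) h'
  simp only [mul_add] at h2
  simp only [barrier]
  linarith

/-- With `q = (a / r) ^ 2`, the square of the left side is `2 r + 2 r √(1 - q) ≤ (4 - q) r`, and `4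
- q ≤ (2 - q / 4) ^ 2`. -/
lemma sqrt_add_sqrt_le {r a : ℝ} (hr : 0 < r) (ha : 0 ≤ a) (har : a ≤ r) :
    √(r + a) + √(r - a) ≤ 2 * √r - (a / r) ^ 2 / 4 * √r := by
  have h1 : 0 ≤ a / r := by positivity
  have h2 : a / r ≤ 1 := (div_le_one hr).2 har
  have h3 : (a / r) ^ 2 ≤ 1 := pow_le_one₀ h1 h2
  have hsr : √r ^ 2 = r := Real.sq_sqrt hr.le
  have hX : √(r + a) ^ 2 = r + a := Real.sq_sqrt (by linarith)
  have hY : √(r - a) ^ 2 = r - a := Real.sq_sqrt (by linarith)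
  have hXY : √(r + a) * √(r - a) ≤ r - (a / r) ^ 2 / 2 * r := by
    rw [← Real.sqrt_mul (by linarith)]
    refine Real.sqrt_le_iff.2 ⟨by nlinarith, ?_⟩
    have h5 : a = a / r * r := by field_simp
    have h4 : (r + a) * (r - a) = r ^ 2 - (a / r) ^ 2 * r ^ 2 := by
      rw [← mul_pow, ← h5]; ring
    rw [h4]
    nlinarith [sq_nonneg ((a / r) ^ 2 / 2 * r)]
  refine abs_le_of_sq_le_sq' ?_ ?_ |>.2
  · have h5 : (2 * √r - (a / r) ^ 2 / 4 * √r) ^ 2 = (2 - (a / r) ^ 2 / 4) ^ 2 * r := by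
      rw [← sub_mul, mul_pow, hsr]
    rw [h5]
    nlinarith [mul_nonneg (sq_nonneg ((a / r) ^ 2 / 4)) hr.le]
  · nlinarith [Real.sqrt_nonneg r]

/-- In a direction close to the inner normal, the square root of the distance is strictly
concave. -/
lemma secondDiff_sqrt_infDist_le [FiniteDimensional ℝ E] {U : Set E} (hU : IsOpen U)
    (hconv : Convex ℝ U) (huniv : U ≠ univ) {x : E} (hx : x ∈ U) :
    ∃ n : E, ‖n‖ = 1 ∧ ∀ v : E, ‖v‖ = 1 → ‖n - v‖ ≤ 1 → ∀ L s D : ℝ, 1 ≤ D → 0 < s →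
      Metric.infDist x Uᶜ ≤ L → s ≤ Metric.infDist x Uᶜ → Metric.infDist x Uᶜ ≤ D * s →
      x + s • v ∈ closure U → x - s • v ∈ closure U →
      √(min (Metric.infDist (x + s • v) Uᶜ) L) + √(min (Metric.infDist (x - s • v) Uᶜ) L) -
        2 * √(min (Metric.infDist x Uᶜ) L) ≤ -(√(Metric.infDist x Uᶜ) / (16 * D ^ 2)) := by
  obtain ⟨z, n, hn, hpos, hxz, hle⟩ := exists_inner_normal hU hconv ⟨x, hx⟩ huniv x
  refine ⟨n, hn, fun v hv hnv L s D hD hs hrL hsr hrs hm1 hm2 => ?_⟩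
  set r := Metric.infDist x Uᶜ with hr
  have hr0 : 0 < r := hs.trans_le hsr
  have hrn : (inner ℝ n (x - z) : ℝ) = r := by
    refine le_antisymm ?_ hle
    have := real_inner_le_norm n (x - z)
    rwa [hn, one_mul, ← dist_eq_norm, ← hxz] at this
  set c : ℝ := inner ℝ n v with hc
  have hc1 : c ≤ 1 := by
    have := real_inner_le_norm n v
    rwa [hn, hv, one_mul] at this
  have hc2 : 1 / 2 ≤ c := by
    have h1 := norm_sub_sq_real n v
    have h2 : ‖n - v‖ ^ 2 ≤ 1 := by nlinarith [norm_nonneg (n - v)]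
    rw [hn, hv] at h1
    linarith
  have h1 : Metric.infDist (x + s • v) Uᶜ ≤ r + s * c := by
    refine (infDist_compl_le_inner hn hpos hm1).trans_eq ?_
    rw [add_sub_right_comm, inner_add_right, inner_smul_right, hrn]
  have h2 : Metric.infDist (x - s • v) Uᶜ ≤ r - s * c := by
    refine (infDist_compl_le_inner hn hpos hm2).trans_eq ?_
    rw [sub_right_comm, inner_sub_right, inner_smul_right, hrn]
  have h3 := sqrt_add_sqrt_le hr0 (a := s * c) (by positivity) (by nlinarith)
  -- Truncation only helps: it lowers the two outer values and leaves the central one unchanged,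
  -- since `r ≤ L`.
  have h4 : √(min (Metric.infDist (x + s • v) Uᶜ) L) ≤ √(r + s * c) :=
    Real.sqrt_le_sqrt ((min_le_left _ _).trans h1)
  have h5 : √(min (Metric.infDist (x - s • v) Uᶜ) L) ≤ √(r - s * c) :=
    Real.sqrt_le_sqrt ((min_le_left _ _).trans h2)
  -- From `c ≥ 1 / 2` and `r ≤ D s`. Squaring and dividing by 4 yields the constant `1 / (16 D ^
  -- 2)`.
  have h6 : 1 / (2 * D) ≤ s * c / r := by
    rw [div_le_div_iff₀ (by positivity) hr0]
    nlinarith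
  have h7 : 1 / (4 * D ^ 2) ≤ (s * c / r) ^ 2 := by
    refine le_trans (le_of_eq ?_) (pow_le_pow_left₀ (by positivity) h6 2)
    field_simp; norm_num
  have h8 : √r / (16 * D ^ 2) ≤ (s * c / r) ^ 2 / 4 * √r := by
    refine le_trans (le_of_eq ?_) (mul_le_mul_of_nonneg_right
      (div_le_div_of_nonneg_right h7 (by norm_num : (0 : ℝ) ≤ 4)) (Real.sqrt_nonneg r))
    field_simp; norm_num
  rw [min_eq_left hrL]
  linarith

end Barrier

/-! ### Estimates at the nodes and the error in terms of the two scales. -/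

lemma HasTaylor.ge_of_mem_closure {E : Type*} [NormedAddCommGroup E] [InnerProductSpace ℝ E]
    {k : ℕ} {β H : ℝ} {Ω : Set E} {w : E → ℝ} {g : E → E →L[ℝ] ℝ}
    (h : HasTaylor k β H Ω w g) (hβ : 0 < β) (hw : ContinuousOn w (closure Ω)) {x y : E}
    (hx : x ∈ Ω) (hy : y ∈ closure Ω) : w x + g x (y - x) - H * dist y x ^ β ≤ w y := by
  refine le_on_closure (s := Ω) (g := w) (f := fun y => w x + g x (y - x) - H * dist y x ^ β)
    (fun z hz => ?_) ?_ hw hy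
  · have := (abs_le.1 (h.2.2 x hx z hz)).1
    linarith
  · refine Continuous.continuousOn ?_
    have h1 : Continuous fun y => dist y x ^ β :=
      (continuous_id.dist continuous_const).rpow_const fun _ => Or.inr hβ.le
    fun_prop

lemma HasTaylor.secondDiff_le {E : Type*} [NormedAddCommGroup E] [InnerProductSpace ℝ E]
    {k : ℕ} {β H : ℝ} {Ω : Set E} {w : E → ℝ} {g : E → E →L[ℝ] ℝ}
    (h : HasTaylor k β H Ω w g) (hβ : 0 < β) (hw : ContinuousOn w (closure Ω)) {x z : E}
    (hx : x ∈ Ω) (h1 : x + z ∈ closure Ω) (h2 : x - z ∈ closure Ω) :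
    w (x + z) + w (x - z) - 2 * w x ≤ 2 * H * ‖z‖ ^ β := by
  have h3 := h.le_of_mem_closure hβ hw hx h1
  have h4 := h.le_of_mem_closure hβ hw hx h2
  rw [dist_eq_norm, add_sub_cancel_left] at h3
  rw [dist_eq_norm, sub_sub_cancel_left, norm_neg, map_neg] at h4
  linarith

variable {d : ℕ} {Ω : Set (EuclideanSpace ℝ (Fin d))} {σ δ θ : ℝ}
  {K : Geometry.SimplicialComplex ℝ (EuclideanSpace ℝ (Fin d))}
  {S : Finset (EuclideanSpace ℝ (Fin d))} {f u uε : EuclideanSpace ℝ (Fin d) → ℝ}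
  {k : ℕ} {β N F : ℝ} {gf gu : EuclideanSpace ℝ (Fin d) → EuclideanSpace ℝ (Fin d) →L[ℝ] ℝ}

/-- Away from the boundary, either the obstacle is almost attained, or some discrete direction has
a small second difference. -/
lemma IsViscositySolution.deep_node (hu : IsViscositySolution Ω f u) (hd : 1 ≤ d) (hΩ : IsOpen Ω)
    (hconv : Convex ℝ Ω) (hne : Ω.Nonempty) (hbdd : Bornology.IsBounded Ω)
    (hfc : ContinuousOn f (closure Ω)) (hk : k = 0 ∨ k = 1) (hβ : 0 < β) (hN : 0 ≤ N) (hF : 0 ≤ F)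
    (hTf : HasTaylor k β F Ω f gf) (hTu : HasTaylor k β N Ω u gu) (hK : IsMesh Ω σ K)
    (hδ : 0 < δ) (hδθ : δ * θ = meshSize K) (hS : IsSphereDiscretization θ S)
    {x : EuclideanSpace ℝ (Fin d)} (hx : x ∈ interiorNodes Ω K)
    (hdeep : d * δ ≤ Metric.infDist x (meshDomain K)ᶜ) :
    f x ≤ u x + (N + F) * (d * δ) ^ β ∨ ∃ v ∈ S, stepSize K δ x = δ ∧
      u (x + stepSize K δ x • v) + u (x - stepSize K δ x • v) - 2 * u x ≤
        2 * N * meshSize K ^ β := by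
  have hd' : (1 : ℝ) ≤ d := by exact_mod_cast hd
  have hstep : stepSize K δ x = δ := by
    rw [hK.stepSize_eq hd hx]
    exact min_eq_left (by nlinarith)
  have hsub := hK.meshDomain_subset hΩ hconv hne
  have hxΩ : x ∈ Ω := hsub (hK.mem_meshDomain_of_interiorNode hx)
  have hucv : ConvexOn ℝ Ω u := hu.convexOn hΩ hconv
  obtain ⟨l, hl⟩ := exists_supporting hΩ hucv (hu.continuousOn.mono subset_closure) hxΩ
  have hl' : ∀ y ∈ closure Ω, u x + l (y - x) ≤ u y := fun y hy =>
    le_on_closure hl (by fun_prop) hu.continuousOn hy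
  rcases hu.exists_contact_or_flat hd hΩ hconv hbdd hfc hxΩ hl' hδ with
    ⟨p, hp, hpe, hpx⟩ | ⟨v0, hv0, hm1, hm2, hu1, hu2⟩
  · left
    -- The contact point is closer to `x` than the complement of the mesh domain, so it is interior
    -- and the gradients can be compared there.
    have hpΩ : p ∈ Ω := by
      by_contra h
      have h1 := Metric.infDist_le_dist_of_mem (x := x) (s := (meshDomain K)ᶜ) (y := p)
        fun h2 => h (hsub h2)
      rw [dist_comm] at h1
      linarith
    have h1 := hTf.sub_le_of_contact hk hTu hΩ
      (fun y hy => hu.le_obstacle hΩ hfc (subset_closure hy)) hpΩ hxΩ hpe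
    have h2 : (N + F) * dist p x ^ β ≤ (N + F) * (d * δ) ^ β :=
      mul_le_mul_of_nonneg_left (Real.rpow_le_rpow dist_nonneg hpx.le hβ.le) (by positivity)
    linarith
  · right
    obtain ⟨v, hv, hvv⟩ := hS.approx v0 hv0
    obtain ⟨hw1, hw2⟩ := hK.add_smul_mem_space hd hδ hx (hS.norm_eq_one v hv)
    refine ⟨v, hv, hstep, ?_⟩
    rw [hstep] at hw1 hw2 ⊢
    refine hTu.secondDiff_le_of_flat hk hβ hN hΩ (convexOn_closure hΩ hne hucv hu.continuousOn)
      hconv hu.continuousOn hxΩ hl' (z := δ • v0) ?_ hm1 hm2 hu1 hu2 (hK.subset hw1)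
      (hK.subset hw2)
    rw [← smul_sub, norm_smul, Real.norm_of_nonneg hδ.le, norm_sub_rev, ← hδθ]
    exact mul_le_mul_of_nonneg_left hvv hδ.le

/-- Near the boundary, an obstacle problem with Hölder data is close to its obstacle. -/
lemma IsViscositySolution.sub_le_near_boundary (hu : IsViscositySolution Ω f u) (hd : 1 ≤ d)
    (hΩ : IsOpen Ω) (hconv : Convex ℝ Ω) (hne : Ω.Nonempty)
    (hfc : ContinuousOn f (closure Ω)) (hβ : 0 < β) (hN : 0 ≤ N) (hF : 0 ≤ F)
    (hTf : HasTaylor 0 β F Ω f gf) (hTu : HasTaylor 0 β N Ω u gu) (hK : IsMesh Ω σ K)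
    (hhδ : meshSize K ≤ δ) {x : EuclideanSpace ℝ (Fin d)} (hx : x ∈ interiorNodes Ω K)
    (hnear : Metric.infDist x (meshDomain K)ᶜ < d * δ) :
    f x ≤ u x + (N + F) * ((d + 1) * δ) ^ β := by
  have hxU := hK.mem_meshDomain_of_interiorNode hx
  have hxΩ : x ∈ Ω := hK.meshDomain_subset hΩ hconv hne hxU
  obtain ⟨z, hz, hxz⟩ := exists_mem_frontier_infDist_compl_eq_dist hxU (hK.meshDomain_ne_univ hd)
  rw [IsMesh.isOpen_meshDomain.frontier_eq, hK.closure_meshDomain] at hz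
  -- A boundary node lies within `h ≤ δ` of the nearest boundary point, hence within `(d + 1) δ` of
  -- `x`, and `u = f` there.
  obtain ⟨p, hp, hpz⟩ := hK.exists_boundaryNode hz.1 hz.2
  have hpc : p ∈ closure Ω := frontier_subset_closure hp.2
  have hpx : dist p x ≤ (d + 1) * δ := by
    have := dist_triangle p z x
    rw [dist_comm z x] at this
    linarith
  have h1 := hTu.le_of_mem_closure hβ hu.continuousOn hxΩ hpc
  have h2 := hTf.ge_of_mem_closure hβ hfc hxΩ hpc
  rw [hTu.1 rfl] at h1
  rw [hTf.1 rfl] at h2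
  simp only [_root_.zero_apply] at h1 h2
  have h3 : (N + F) * dist p x ^ β ≤ (N + F) * ((d + 1) * δ) ^ β :=
    mul_le_mul_of_nonneg_left (Real.rpow_le_rpow dist_nonneg hpx hβ.le) (by positivity)
  linarith [hu.boundary p hp.2]

/-- The discrete error in terms of the two scales. -/
lemma IsDiscreteSolution.sub_le (h : IsDiscreteSolution Ω K δ S f uε)
    (hu : IsViscositySolution Ω f u) (hd : 1 ≤ d) (hΩ : IsOpen Ω)
    (hconv : Convex ℝ Ω) (hne : Ω.Nonempty) (hbdd : Bornology.IsBounded Ω)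
    (hfc : ContinuousOn f (closure Ω)) (hk : k = 0 ∨ k = 1) (hβ : 0 < β) (hβk : k = 1 → 1 ≤ β)
    (hβ2 : β ≤ 2) (hN : 0 < N) (hF : 0 ≤ F)
    (hTf : HasTaylor k β F Ω f gf) (hTu : HasTaylor k β N Ω u gu) (hK : IsMesh Ω σ K)
    (hδ : 0 < δ) (hδθ : δ * θ = meshSize K) (hθ : θ ≤ 1) (hS : IsSphereDiscretization θ S)
    {R : ℝ} (hR : ∀ y ∈ closure Ω, ‖y‖ ≤ R) {x : EuclideanSpace ℝ (Fin d)} (hx : x ∈ K.space) :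
    uε x ≤ u x + N * meshSize K ^ β + 3 * R ^ 2 * (N * meshSize K ^ β / δ ^ 2) +
      16 * d ^ 3 * (3 + 2 * σ) * (N * δ ^ β) + (d + 1) ^ 2 * ((N + F) * δ ^ β) := by
  have hd' : (1 : ℝ) ≤ d := by exact_mod_cast hd
  have hσ := hK.one_le_sigma hd
  have hh := hK.meshSize_pos hd
  set η := meshSize K with hη
  have hhδ : η ≤ δ := by rw [← hδθ]; nlinarith
  -- At deep nodes the paraboloid contributes `-2 κ δ^2 = -6 N h^β`, against `2 N h^β` from the flat
  -- direction and `2 N h^β` from interpolation.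
  set κ := 3 * (N * η ^ β / δ ^ 2) with hκ
  have hηβ : 0 < η ^ β := Real.rpow_pos_of_pos hh β
  have hκ0 : 0 < κ := by positivity
  have hκδ : κ * δ ^ 2 = 3 * (N * η ^ β) := by rw [hκ]; field_simp
  -- Near the boundary the square root contributes `-(3 + 2 σ) X` with `X = N δ^(β - 1/2) √r`. The
  -- second difference of `u` costs at most `2 X` and interpolation at most `2 σ X`.
  set G := 16 * d ^ 2 * (3 + 2 * σ) * (N * δ ^ (β - 1 / 2)) with hG
  have hδβ : 0 < δ ^ (β - 1 / 2) := Real.rpow_pos_of_pos hδ _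
  have hG0 : 0 < G := by positivity
  set M := (d + 1) ^ 2 * ((N + F) * δ ^ β) with hM
  have hM0 : 0 ≤ M := by positivity
  have hMge : ∀ c : ℝ, 0 ≤ c → c ≤ d + 1 → (N + F) * (c * δ) ^ β ≤ M := by
    intro c hc0 hc
    have h1 : (c * δ) ^ β ≤ (d + 1) ^ 2 * δ ^ β := by
      rw [Real.mul_rpow hc0 hδ.le]
      refine mul_le_mul_of_nonneg_right ?_ (by positivity)
      refine (Real.rpow_le_rpow hc0 hc hβ.le).trans ?_
      refine (Real.rpow_le_rpow_of_exponent_le (by linarith) hβ2).trans_eq ?_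
      exact Real.rpow_two _
    refine (mul_le_mul_of_nonneg_left h1 (by positivity)).trans_eq ?_
    rw [hM]; ring
  let b := barrier κ G R (d * δ) (meshDomain K)
  have hU : IsOpen (meshDomain K) := IsMesh.isOpen_meshDomain
  have huniv := hK.meshDomain_ne_univ hd
  have hsqrt : ConcaveOn ℝ K.space fun y => √(min (Metric.infDist y (meshDomain K)ᶜ) (d * δ)) := by
    rw [← hK.closure_meshDomain]
    exact concaveOn_sqrt_truncated_infDist hU hK.convex_meshDomain hK.nonempty_meshDomain huniv
      (by positivity)
  have hbc : ConcaveOn ℝ K.space b := by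
    rw [← hK.closure_meshDomain]
    exact concaveOn_barrier hU hK.convex_meshDomain hK.nonempty_meshDomain huniv hκ0.le hG0.le
      (by positivity)
  have hmain := h.le_of_barrier (u := u) (b := b) (e := N * η ^ β) hK hd hδ hS hM0
    (fun T c y hT hc hc1 hcy hdist => hTu.sum_le hβ hN.le hΩ hconv hne hu.continuousOn T c
      (fun p => p) hc hc1 (fun p hp => hK.subset (K.vertices_subset_space (hT p hp))) hcy hdist)
    hbc (fun y hy => barrier_nonneg hκ0.le hG0.le (hR y (hK.subset hy))) hu.boundary ?_ hx
  · have h1 : b x ≤ κ * R ^ 2 + G * √(d * δ) := barrier_le hκ0.le hG0.le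
    have h2 : √(d * δ) ≤ d * √δ := by
      rw [Real.sqrt_mul (by positivity)]
      refine mul_le_mul_of_nonneg_right (Real.sqrt_le_iff.2 ⟨by positivity, by nlinarith⟩)
        (Real.sqrt_nonneg _)
    have h3 : δ ^ (β - 1 / 2) * √δ = δ ^ β := by
      rw [Real.sqrt_eq_rpow, ← Real.rpow_add hδ]; ring_nf
    have h4 : G * √(d * δ) ≤ 16 * d ^ 3 * (3 + 2 * σ) * (N * δ ^ β) := by
      refine (mul_le_mul_of_nonneg_left h2 hG0.le).trans_eq ?_
      rw [hG, ← h3]; ring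
    have h5 : κ * R ^ 2 = 3 * R ^ 2 * (N * η ^ β / δ ^ 2) := by rw [hκ]; ring
    linarith
  · intro y hy
    have hyU := hK.mem_meshDomain_of_interiorNode hy
    have hyΩ : y ∈ Ω := hK.meshDomain_subset hΩ hconv hne hyU
    have hs := hK.stepSize_pos hd hδ hy
    rcases le_or_gt (d * δ) (Metric.infDist y (meshDomain K)ᶜ) with hdeep | hnear
    · rcases hu.deep_node hd hΩ hconv hne hbdd hfc hk hβ hN.le hF hTf hTu hK hδ hδθ hS hy hdeep with
        h1 | ⟨v, hv, hstep, h1⟩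
      · exact Or.inl (h1.trans (by linarith [hMge d (by linarith) (by linarith)]))
      · right
        refine ⟨v, hv, ?_⟩
        obtain ⟨hm1, hm2⟩ := hK.add_smul_mem_space hd hδ hy (hS.norm_eq_one v hv)
        have h2 := secondDiff_barrier κ G R (d * δ) (meshDomain K) y (stepSize K δ y • v)
        have h3 := mul_le_mul_of_nonneg_left (secondDiff_nonpos_of_concaveOn hsqrt hm1 hm2) hG0.le
        rw [mul_zero] at h3
        have h4 : ‖stepSize K δ y • v‖ = δ := by
          rw [norm_smul, hS.norm_eq_one v hv, mul_one, hstep, Real.norm_of_nonneg hδ.le]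
        rw [h4] at h2
        have h5 : 0 < N * η ^ β := by positivity
        simp only [b]
        linarith
    · rcases hk with rfl | rfl
      · exact Or.inl ((hu.sub_le_near_boundary hd hΩ hconv hne hfc hβ hN.le hF hTf hTu hK hhδ hy
          hnear).trans (by linarith [hMge (d + 1) (by linarith) le_rfl]))
      · right
        obtain ⟨n, hn, hnorm⟩ := secondDiff_sqrt_infDist_le hU hK.convex_meshDomain huniv hyU
        obtain ⟨v, hv, hnv⟩ := hS.approx n hn
        refine ⟨v, hv, ?_⟩
        have hvn := hS.norm_eq_one v hv
        obtain ⟨hm1, hm2⟩ := hK.add_smul_mem_space hd hδ hy hvn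
        have hseq := hK.stepSize_eq (δ := δ) hd hy
        set s := stepSize K δ y with hs_def
        set r := Metric.infDist y (meshDomain K)ᶜ with hr_def
        have hsδ : s ≤ δ := hseq ▸ min_le_left _ _
        have hsr : s ≤ r := hseq ▸ min_le_right _ _
        have hr0 : 0 < r := hs.trans_le hsr
        have hrs : r ≤ d * s := by
          rcases min_choice δ r with h1 | h1
          · rw [hseq, h1]; exact hnear.le
          · rw [hseq, h1]; nlinarith
        have h1 := hnorm v hvn (hnv.trans hθ) (d * δ) s d hd' hs hnear.le hsr hrs
          (by rwa [hK.closure_meshDomain]) (by rwa [hK.closure_meshDomain])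
        have h2 := mul_le_mul_of_nonneg_left h1 hG0.le
        have h3 := secondDiff_barrier κ G R (d * δ) (meshDomain K) y (s • v)
        have h4 := hTu.secondDiff_le hβ hu.continuousOn hyΩ (hK.subset hm1) (hK.subset hm2)
        rw [norm_smul, hvn, mul_one, Real.norm_of_nonneg hs.le] at h4
        have h5 : 0 ≤ 2 * κ * ‖s • v‖ ^ 2 := by positivity
        have hsqr : 0 < √r := Real.sqrt_pos.2 hr0
        have hβ1 := hβk rfl
        -- Here `β ≥ 1` makes `β - 1/2` a nonnegative exponent, so that factor may be enlarged to a
        -- power of `δ` while `√t` is kept to be compared with `√r`.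
        have hpow : ∀ t, 0 < t → t ≤ δ → t ^ β ≤ δ ^ (β - 1 / 2) * √t := by
          intro t ht0 ht
          have h6 : t ^ β = t ^ (β - 1 / 2) * √t := by
            rw [Real.sqrt_eq_rpow, ← Real.rpow_add ht0]; ring_nf
          rw [h6]
          exact mul_le_mul_of_nonneg_right (Real.rpow_le_rpow ht0.le ht (by linarith))
            (Real.sqrt_nonneg _)
        have h6 : s ^ β ≤ δ ^ (β - 1 / 2) * √r :=
          (hpow s hs hsδ).trans (mul_le_mul_of_nonneg_left (Real.sqrt_le_sqrt hsr) hδβ.le)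
        have h7 : √η ≤ σ * √r := by
          have h8 := Real.sqrt_le_sqrt (hK.meshSize_le_infDist hd hy)
          rwa [Real.sqrt_mul (by positivity), Real.sqrt_sq (by linarith)] at h8
        have h8 : η ^ β ≤ δ ^ (β - 1 / 2) * (σ * √r) :=
          (hpow η hh hhδ).trans (mul_le_mul_of_nonneg_left h7 hδβ.le)
        have h9 : G * -(√r / (16 * d ^ 2)) = -((3 + 2 * σ) * (N * (δ ^ (β - 1 / 2) * √r))) := by
          rw [hG]; field_simp
        have h10 : 0 < N * (δ ^ (β - 1 / 2) * √r) := by positivity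
        have h11 := mul_le_mul_of_nonneg_left h6 hN.le
        have h12 := mul_le_mul_of_nonneg_left h8 hN.le
        rw [h9] at h2
        simp only [b]
        rw [h3]
        set X := N * (δ ^ (β - 1 / 2) * √r) with hX
        have h13 : N * (δ ^ (β - 1 / 2) * (σ * √r)) = σ * X := by rw [hX]; ring
        have h14 : (3 + 2 * σ) * X = 3 * X + 2 * (σ * X) := by ring
        rw [h13] at h12
        rw [h14] at h2
        linarith

/-- Since `R ^ (2 + β) = N / (N + F)`, the choice of `δ` makes `(N + F) δ^β` and `N h^β / δ^2` both
equal to `(N + F) R^β h^(β^2 / (2 + β))`. The factor `R^β` is dropped because `R ≤ 1`. -/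
lemma scale_estimates {β h R : ℝ} (hN : 0 < N) (hF : 0 ≤ F) (hβ : 0 < β) (hh : 0 < h)
    (hR : R = N ^ (1 / (2 + β)) * (N + F) ^ (-(1 / (2 + β))))
    (hδ : δ = R * h ^ (β / (2 + β))) (hθ : θ = R⁻¹ * h ^ (2 / (2 + β))) (hθ1 : θ ≤ 1) :
    0 < δ ∧ δ * θ = h ∧ h ≤ δ ∧ (N + F) * δ ^ β ≤ (N + F) * h ^ (β ^ 2 / (2 + β)) ∧
      N * h ^ β / δ ^ 2 ≤ (N + F) * h ^ (β ^ 2 / (2 + β)) := by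
  have hNF : 0 < N + F := by linarith
  have hR0 : 0 < R := by rw [hR]; positivity
  have hδ0 : 0 < δ := by rw [hδ]; positivity
  have hδθ : δ * θ = h := by
    have h1 : h ^ (β / (2 + β)) * h ^ (2 / (2 + β)) = h := by
      rw [← Real.rpow_add hh, ← add_div, add_comm β, div_self (by positivity), Real.rpow_one]
    calc δ * θ = R * R⁻¹ * (h ^ (β / (2 + β)) * h ^ (2 / (2 + β))) := by rw [hδ, hθ]; ring
      _ = h := by rw [h1, mul_inv_cancel₀ hR0.ne', one_mul]
  have hRt : R = (N / (N + F)) ^ (1 / (2 + β)) := by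
    rw [hR, Real.div_rpow hN.le hNF.le, Real.rpow_neg hNF.le, div_eq_mul_inv (N ^ _)]
  have ht0 : 0 < N / (N + F) := by positivity
  have ht1 : N / (N + F) ≤ 1 := (div_le_one hNF).2 (by linarith)
  have hR1 : R ≤ 1 := hRt ▸ Real.rpow_le_one ht0.le ht1 (by positivity)
  refine ⟨hδ0, hδθ, by nlinarith, ?_, ?_⟩
  · refine mul_le_mul_of_nonneg_left ?_ hNF.le
    rw [hδ, Real.mul_rpow hR0.le (by positivity), ← Real.rpow_mul hh.le]
    have h1 : R ^ β ≤ 1 := Real.rpow_le_one hR0.le hR1 hβ.le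
    have h2 : β / (2 + β) * β = β ^ 2 / (2 + β) := by ring
    rw [h2]
    exact mul_le_of_le_one_left (by positivity) h1
  · have hR2 : N ≤ (N + F) * R ^ 2 := by
      have h1 : N / (N + F) ≤ R ^ 2 := by
        rw [hRt, ← Real.rpow_natCast, ← Real.rpow_mul ht0.le]
        conv_lhs => rw [← Real.rpow_one (N / (N + F))]
        refine Real.rpow_le_rpow_of_exponent_ge ht0 ht1 ?_
        rw [div_mul_eq_mul_div, div_le_one (by positivity)]
        push_cast; linarith
      rwa [div_le_iff₀' hNF] at h1
    have h2 : h ^ β = h ^ (β ^ 2 / (2 + β)) * (h ^ (β / (2 + β))) ^ 2 := by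
      rw [← Real.rpow_natCast (h ^ (β / (2 + β))) 2, ← Real.rpow_mul hh.le, ← Real.rpow_add hh]
      congr 1
      push_cast
      field_simp
      ring
    rw [div_le_iff₀ (by positivity), h2, hδ]
    have h3 : 0 ≤ h ^ (β ^ 2 / (2 + β)) * (h ^ (β / (2 + β))) ^ 2 := by positivity
    nlinarith [mul_le_mul_of_nonneg_right hR2 h3]

end

end ConvexEnvelope

end

/-! ### Assembly of the final estimate. -/

open ConvexEnvelope in
theorem corollary3p6 (d : ℕ) (hd : 1 ≤ d) (Ω : Set (EuclideanSpace ℝ (Fin d)))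
    (hΩ_nonempty : Ω.Nonempty) (hΩ_open : IsOpen Ω) (hΩ_bounded : Bornology.IsBounded Ω)
    (hΩ_convex : Convex ℝ Ω) (hΩ_strictConvex : StrictConvex ℝ (closure Ω)) (σ : ℝ) :
    ∃ C : ℝ, ∀ (k : ℕ) (α : ℝ≥0), (k = 0 ∨ k = 1) → 0 < α → α ≤ 1 →
      ∀ f u : EuclideanSpace ℝ (Fin d) → ℝ,
        IsHolderClass k α Ω f → IsHolderClass k α Ω u → IsViscositySolution Ω f u →
        0 < holderSeminorm k α Ω u →
      ∀ (K : Geometry.SimplicialComplex ℝ (EuclideanSpace ℝ (Fin d))), IsMesh Ω σ K →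
      ∀ h δ θ : ℝ, h = meshSize K →
        δ = scaleFactor k α Ω f u * h ^ (((k : ℝ) + α) / (2 + k + α)) →
        θ = (scaleFactor k α Ω f u)⁻¹ * h ^ (2 / (2 + (k : ℝ) + α)) →
        θ ≤ 1 →
      ∀ S : Finset (EuclideanSpace ℝ (Fin d)), IsSphereDiscretization θ S →
      ∀ uε : EuclideanSpace ℝ (Fin d) → ℝ, IsDiscreteSolution Ω K δ S f uε →
        (∀ x ∈ meshDomain K, |u x - uε x| ≤
          C * (holderSeminorm k α Ω u + holderSeminorm k α Ω f) *
            h ^ (((k : ℝ) + α) ^ 2 / (2 + k + α))) ∧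
        (k = 1 → α = 1 → ∀ x ∈ meshDomain K, |u x - uε x| ≤
          C * (holderSeminorm k α Ω u + holderSeminorm k α Ω f) * h) ∧
        (k = 0 → α = 1 → ∀ x ∈ meshDomain K, |u x - uε x| ≤
          C * (holderSeminorm k α Ω u + holderSeminorm k α Ω f) * h ^ (1 / 3 : ℝ)) := by
  obtain ⟨R, hR⟩ := hΩ_bounded.isCompact_closure.isBounded.exists_norm_le
  refine ⟨1 + 3 * R ^ 2 + 16 * d ^ 3 * (3 + 2 * σ) + (d + 1) ^ 2, ?_⟩
  intro k α hk hα hα1 f u hf hu hvisc hpos K hK h δ θ hh hδ hθ hθ1 S hS uε huε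
  set C : ℝ := 1 + 3 * R ^ 2 + 16 * d ^ 3 * (3 + 2 * σ) + (d + 1) ^ 2 with hC
  suffices hmain : ∀ x ∈ meshDomain K, |u x - uε x| ≤
      C * (holderSeminorm k α Ω u + holderSeminorm k α Ω f) *
        h ^ (((k : ℝ) + α) ^ 2 / (2 + k + α)) by
    refine ⟨hmain, ?_, ?_⟩
    · rintro rfl rfl x hx
      convert! hmain x hx using 2
      norm_num
    · rintro rfl rfl x hx
      convert! hmain x hx using 2
      norm_num
  intro x hx
  have hα' : (0 : ℝ) < α := by exact_mod_cast hα
  have hα1' : (α : ℝ) ≤ 1 := by exact_mod_cast hα1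
  have hβ : 0 < (k : ℝ) + α := by positivity
  have hσ := hK.one_le_sigma hd
  have hF : 0 ≤ holderSeminorm k α Ω f := NNReal.coe_nonneg _
  obtain ⟨gf, hTf⟩ := hf.exists_hasTaylor hk hΩ_open hΩ_convex
  obtain ⟨gu, hTu⟩ := hu.exists_hasTaylor hk hΩ_open hΩ_convex
  have hh0 : 0 < h := hh ▸ hK.meshSize_pos hd
  rw [add_assoc] at hδ hθ ⊢
  have hscale : scaleFactor k α Ω f u =
      holderSeminorm k α Ω u ^ (1 / (2 + ((k : ℝ) + α))) *
        (holderSeminorm k α Ω u + holderSeminorm k α Ω f) ^ (-(1 / (2 + ((k : ℝ) + α)))) := by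
    rw [scaleFactor, add_assoc]
  obtain ⟨hδ0, hδθ, hhδ, hE1, hE2⟩ := scale_estimates hpos hF hβ hh0 hscale hδ hθ hθ1
  set N := holderSeminorm k α Ω u with hN
  set F := holderSeminorm k α Ω f with hF'
  set β : ℝ := (k : ℝ) + α with hβ'
  set ER := (N + F) * h ^ (β ^ 2 / (2 + β)) with hER
  have hxs : x ∈ K.space := interior_subset hx
  have hlow : u x ≤ uε x := huε.le_of_convexOn hK hd hδ0 hS
    (convexOn_closure hΩ_open hΩ_nonempty (hvisc.convexOn hΩ_open hΩ_convex) hvisc.continuousOn)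
    (fun y hy => hvisc.le_obstacle hΩ_open hf.continuousOn hy) hxs
  have hup := huε.sub_le hvisc hd hΩ_open hΩ_convex hΩ_nonempty hΩ_bounded hf.continuousOn hk hβ
    (fun h1 => by rw [hβ', h1]; push_cast; linarith)
    (by rcases hk with rfl | rfl <;> · rw [hβ']; push_cast; linarith)
    hpos hF hTf hTu hK hδ0 (hδθ.trans hh) hθ1 hS hR hxs
  rw [← hh] at hup
  have hNδ : N * δ ^ β ≤ ER := le_trans
    (mul_le_mul_of_nonneg_right (by linarith) (by positivity)) hE1
  -- The interpolation error is dominated through `h ≤ δ`, which follows from `θ ≤ 1`.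
  have hNh : N * h ^ β ≤ ER := le_trans
    (mul_le_mul_of_nonneg_left (Real.rpow_le_rpow hh0.le hhδ hβ.le) hpos.le) hNδ
  rw [abs_sub_comm, abs_of_nonneg (sub_nonneg.2 hlow), mul_assoc, ← hER, hC]
  have h1 : 3 * R ^ 2 * (N * h ^ β / δ ^ 2) ≤ 3 * R ^ 2 * ER :=
    mul_le_mul_of_nonneg_left hE2 (by positivity)
  have h2 : 16 * (d : ℝ) ^ 3 * (3 + 2 * σ) * (N * δ ^ β) ≤ 16 * d ^ 3 * (3 + 2 * σ) * ER :=
    mul_le_mul_of_nonneg_left hNδ (by positivity)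
  have h3 : ((d : ℝ) + 1) ^ 2 * ((N + F) * δ ^ β) ≤ (d + 1) ^ 2 * ER :=
    mul_le_mul_of_nonneg_left hE1 (by positivity)
  linarith
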